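/- Let $k$ be an algebraically closed field of arbitrary characteristic. A lattice is a free abelian group of finite rank; a fan in a lattice $N$ is a finite nonempty set of strongly convex rational polyhedral cones in $N_{\mathbf R}=N\otimes_{\mathbf Z}\mathbf R$ that contains every face of each of its cones and in which any two cones intersect in a common face. Let $X$ and $Y$ be the toric varieties over $k$ defined by fans $\Delta_X$ and $\Delta_Y$ in lattices $N_X$ and $N_Y$, with tori $T_X$ and $T_Y$. Let $f\colon X\to Y$ be a proper toric map corresponding to the lattice map $f_N\colon N_X\to N_Y$, that is, a proper morphism over $k$ whose restriction to $T_X$ is the homomorphism of algebraic groups $T_X\to T_Y$ induced by $f_N$. A morphism $g$ is called a fibration if it is proper and the canonical map $\mathcal O\to g_*\mathcal O$ is an isomorphism. The Stein factorization of a proper morphism $f\colon X\to Y$ is the factorization $f=h\circ g$, unique up to unique isomorphism, such that $g\colon X\to Z$ is a fibration and $h\colon Z\to Y$ is finite. Then: (i) $f$ is surjective if and only if $\mathrm{Coker}(f_N)$ is finite. (ii) $f$ is a fibration if and only if $f_N$ is surjective. (iii) Suppose that $f$ is surjective. Let $N_Z=f_N(N_X)$, and let $\Delta_Z$ be the fan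 $\Delta_Y$ regarded as a fan in $N_Z$ via the identification $(N_Z)_{\mathbf R}=(N_Y)_{\mathbf R}$; let $Z$ be the toric variety defined by $\Delta_Z$. Then the factorization $N_X\overset{g_N}{\to}N_Z\overset{h_N}{\hookrightarrow}N_Y$ of $f_N$ induces toric maps $g\colon X\to Z$ and $h\colon Z\to Y$ such that $f=h\circ g$ is the Stein factorization of $f$. -/

import Mathlib

open CategoryTheory CategoryTheory.Limits AlgebraicGeometry TensorProduct

universe u

noncomputable section

namespace Toric

section Cones

variable {N : Type u} [AddCommGroup N]

/-- The real linear form on `N_ℝ = ℝ ⊗ N` defined by `m` in the dual lattice `M = Hom(N, ℤ)`. -/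
def realForm (m : Module.Dual ℤ N) : ℝ ⊗[ℤ] N →ₗ[ℝ] ℝ :=
  ((Algebra.linearMap ℤ ℝ) ∘ₗ m).liftBaseChange ℝ

theorem realForm_tmul (m : Module.Dual ℤ N) (n : N) : realForm m (1 ⊗ₜ[ℤ] n) = (m n : ℝ) := by
  simp [realForm]

theorem realForm_add (m m' : Module.Dual ℤ N) : realForm (m + m') = realForm m + realForm m' := by
  ext n
  simp [realForm]

theorem realForm_zero : realForm (0 : Module.Dual ℤ N) = 0 := by
  ext n
  simp [realForm]

/-- The convex cone in `N_ℝ` generated by a finite set of lattice vectors. -/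
def latticeHull (S : Finset N) : PointedCone ℝ (ℝ ⊗[ℤ] N) :=
  PointedCone.hull ℝ ((fun n : N => (1 : ℝ) ⊗ₜ[ℤ] n) '' (S : Set N))

/-- A rational polyhedral cone. -/
def IsRationalPolyhedral (σ : PointedCone ℝ (ℝ ⊗[ℤ] N)) : Prop :=
  ∃ S : Finset N, σ = latticeHull S

/-- `τ` is a face of `σ`: it is cut out of `σ` by a linear form that is nonnegative on `σ`. -/
def IsFace (τ σ : PointedCone ℝ (ℝ ⊗[ℤ] N)) : Prop :=
  ∃ ℓ : Module.Dual ℝ (ℝ ⊗[ℤ] N), (∀ x ∈ σ, 0 ≤ ℓ x) ∧ ∀ x, x ∈ τ ↔ x ∈ σ ∧ ℓ x = 0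

/-- The monoid `σ^∨ ∩ M`. -/
def dualMonoid (σ : PointedCone ℝ (ℝ ⊗[ℤ] N)) : AddSubmonoid (Module.Dual ℤ N) where
  carrier := {m | ∀ x ∈ σ, 0 ≤ realForm m x}
  zero_mem' := by intro x _; simp [realForm_zero]
  add_mem' := by
    intro a b ha hb x hx
    rw [realForm_add]
    exact add_nonneg (ha x hx) (hb x hx)

theorem dualMonoid_anti {σ τ : PointedCone ℝ (ℝ ⊗[ℤ] N)} (h : σ ≤ τ) :
    dualMonoid τ ≤ dualMonoid σ := fun _ hm x hx => hm x (h hx)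

theorem nonneg_of_mem_latticeHull {S : Finset N} (ℓ : Module.Dual ℝ (ℝ ⊗[ℤ] N))
    (h : ∀ s ∈ S, 0 ≤ ℓ (1 ⊗ₜ[ℤ] s)) : ∀ x ∈ latticeHull S, 0 ≤ ℓ x := by
  intro x hx
  unfold latticeHull PointedCone.hull at hx
  induction hx using Submodule.span_induction with
  | mem y hy => obtain ⟨s, hs, rfl⟩ := hy; exact h s hs
  | zero => simp
  | add y z _ _ hy hz => rw [map_add]; exact add_nonneg hy hz
  | smul a y _ hy =>
    rw [LinearMap.map_smul_of_tower]
    exact smul_nonneg a.2 hy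

theorem tmul_mem_latticeHull {S : Finset N} {s : N} (hs : s ∈ S) :
    (1 : ℝ) ⊗ₜ[ℤ] s ∈ latticeHull S :=
  Submodule.subset_span ⟨s, hs, rfl⟩

theorem eq_zero_of_mem_latticeHull {S : Finset N} (ℓ ℓ' : Module.Dual ℝ (ℝ ⊗[ℤ] N))
    (h : ∀ s ∈ S, 0 ≤ ℓ (1 ⊗ₜ[ℤ] s))
    (h' : ∀ s ∈ S, ℓ (1 ⊗ₜ[ℤ] s) = 0 → ℓ' (1 ⊗ₜ[ℤ] s) = 0) :
    ∀ x ∈ latticeHull S, ℓ x = 0 → ℓ' x = 0 := by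
  intro x hx
  have key : 0 ≤ ℓ x ∧ (ℓ x = 0 → ℓ' x = 0) := by
    unfold latticeHull PointedCone.hull at hx
    induction hx using Submodule.span_induction with
    | mem y hy => obtain ⟨s, hs, rfl⟩ := hy; exact ⟨h s hs, h' s hs⟩
    | zero => simp
    | add y z _ _ hy hz =>
      simp only [map_add]
      refine ⟨add_nonneg hy.1 hz.1, fun h0 => ?_⟩
      rw [hy.2 (by linarith [hy.1, hz.1]), hz.2 (by linarith [hy.1, hz.1]), add_zero]
    | smul a y _ hy =>
      obtain ⟨a, ha⟩ := a
      have e1 : ∀ f : Module.Dual ℝ (ℝ ⊗[ℤ] N), f ((⟨a, ha⟩ : {c : ℝ // 0 ≤ c}) • y) = a * f y :=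
        fun f => f.map_smul a y
      rw [e1, e1]
      refine ⟨mul_nonneg ha hy.1, fun h0 => ?_⟩
      rcases mul_eq_zero.1 h0 with h1 | h1
      · simp [h1]
      · simp [hy.2 h1]
  exact key.2

/-- Finitely many weak inequalities with a real solution have an integral solution with the same
vanishing pattern. -/
theorem exists_integral_form [Module.Finite ℤ N] (S : Finset N) (ℓ : N →ₗ[ℤ] ℝ)
    (h : ∀ s ∈ S, 0 ≤ ℓ s) :
    ∃ m : Module.Dual ℤ N, ∀ s ∈ S, 0 ≤ m s ∧ (m s = 0 ↔ ℓ s = 0) := by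
  let P := LinearMap.range ℓ
  let b := Module.Free.chooseBasis ℤ P
  let c := fun i => b.coord i ∘ₗ ℓ.rangeRestrict
  have hc : ∀ n, ℓ n = ∑ i, (c i n : ℝ) * (b i : ℝ) := by
    intro n
    have := congrArg (Subtype.val : P → ℝ) (b.sum_repr (ℓ.rangeRestrict n))
    simp only [AddSubmonoidClass.coe_finsetSum, Submodule.coe_smul, zsmul_eq_mul] at this
    simpa [c, eq_comm] using this
  obtain ⟨n, hn⟩ : ∃ n : ℕ, ∀ s ∈ S, 0 < ℓ s → ∑ i, |(c i s : ℝ)| < n * ℓ s := by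
    have : ∀ s : N, ∃ n : ℕ, 0 < ℓ s → ∑ i, |(c i s : ℝ)| < n * ℓ s := by
      intro s
      by_cases hs : 0 < ℓ s
      · obtain ⟨n, hn⟩ := exists_nat_gt ((∑ i, |(c i s : ℝ)|) / ℓ s)
        exact ⟨n, fun _ => (div_lt_iff₀ hs).1 hn⟩
      · exact ⟨0, fun h => absurd h hs⟩
    choose f hf using this
    refine ⟨S.sup f, fun s hs h0 => (hf s h0).trans_le ?_⟩
    gcongr
    exact_mod_cast Finset.le_sup hs
  refine ⟨∑ i, ⌊n * (b i : ℝ)⌋ • c i, fun s hs => ?_⟩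
  have hval : (((∑ i, ⌊n * (b i : ℝ)⌋ • c i) s : ℤ) : ℝ) = ∑ i, (⌊n * (b i : ℝ)⌋ : ℝ) * c i s := by
    simp [LinearMap.sum_apply]
  rcases (h s hs).eq_or_lt with h0 | h0
  · have : ∀ i, c i s = 0 := by
      intro i
      have : ℓ.rangeRestrict s = 0 := Subtype.ext h0.symm
      simp [c, this]
    simp [LinearMap.sum_apply, this, h0]
  · have hpos : (0 : ℝ) < (((∑ i, ⌊n * (b i : ℝ)⌋ • c i) s : ℤ) : ℝ) := by
      rw [hval]
      have h1 : ∀ i, (n * (b i : ℝ)) * c i s - |(c i s : ℝ)| ≤ (⌊n * (b i : ℝ)⌋ : ℝ) * c i s := by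
        intro i
        have e : (⌊n * (b i : ℝ)⌋ : ℝ) = n * (b i : ℝ) - Int.fract (n * (b i : ℝ)) := by
          rw [Int.self_sub_fract]
        rw [e, sub_mul]
        have h2 : Int.fract (n * (b i : ℝ)) * c i s ≤ 1 * |(c i s : ℝ)| :=
          (mul_le_mul_of_nonneg_left (le_abs_self _) (Int.fract_nonneg _)).trans
            (mul_le_mul_of_nonneg_right (Int.fract_lt_one _).le (abs_nonneg _))
        linarith
      have h3 := Finset.sum_le_sum fun i (_ : i ∈ Finset.univ) => h1 i
      rw [Finset.sum_sub_distrib] at h3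
      have h4 : ∑ i, (n * (b i : ℝ)) * c i s = n * ℓ s := by
        rw [hc s, Finset.mul_sum]
        exact Finset.sum_congr rfl fun i _ => by ring
      linarith [hn s hs h0]
    have hpos' : 0 < (∑ i, ⌊n * (b i : ℝ)⌋ • c i) s := by exact_mod_cast hpos
    exact ⟨hpos'.le, ⟨fun e => absurd e hpos'.ne', fun e => absurd e h0.ne'⟩⟩

/-- `m` in `τ^∨ ∩ M` cuts out the face `σ` of `τ`. -/
def CutsOut (m : Module.Dual ℤ N) (σ τ : PointedCone ℝ (ℝ ⊗[ℤ] N)) : Prop :=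
  m ∈ dualMonoid τ ∧ ∀ x, x ∈ σ ↔ x ∈ τ ∧ realForm m x = 0

theorem IsFace.exists_cutsOut [Module.Finite ℤ N] {σ τ : PointedCone ℝ (ℝ ⊗[ℤ] N)}
    (hτ : IsRationalPolyhedral τ) (h : IsFace σ τ) : ∃ m, CutsOut m σ τ := by
  obtain ⟨S, rfl⟩ := hτ
  obtain ⟨ℓ, h0, h1⟩ := h
  obtain ⟨m, hm⟩ := exists_integral_form S
    ((ℓ.restrictScalars ℤ) ∘ₗ (TensorProduct.mk ℤ ℝ N 1)) fun s hs => h0 _ (tmul_mem_latticeHull hs)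
  have hm' : ∀ s ∈ S, 0 ≤ realForm m (1 ⊗ₜ[ℤ] s) := fun s hs => by
    rw [realForm_tmul]; exact_mod_cast (hm s hs).1
  refine ⟨m, nonneg_of_mem_latticeHull _ hm', fun x => ?_⟩
  rw [h1]
  refine and_congr_right fun hx => ⟨?_, ?_⟩
  · refine eq_zero_of_mem_latticeHull _ _ (fun s hs => h0 _ (tmul_mem_latticeHull hs)) ?_ x hx
    intro s hs h
    rw [realForm_tmul]
    exact_mod_cast (hm s hs).2.2 h
  · refine eq_zero_of_mem_latticeHull _ _ hm' ?_ x hx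
    intro s hs h
    rw [realForm_tmul] at h
    exact (hm s hs).2.1 (by exact_mod_cast h)

theorem CutsOut.inf {m₁ m₂ : Module.Dual ℤ N} {σ₁ σ₂ τ : PointedCone ℝ (ℝ ⊗[ℤ] N)}
    (h₁ : CutsOut m₁ σ₁ τ) (h₂ : CutsOut m₂ σ₂ τ) : CutsOut (m₁ + m₂) (σ₁ ⊓ σ₂) τ := by
  refine ⟨add_mem h₁.1 h₂.1, fun x => ?_⟩
  rw [Submodule.mem_inf, h₁.2, h₂.2, realForm_add, LinearMap.add_apply]
  constructor
  · rintro ⟨⟨hx, e1⟩, _, e2⟩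
    exact ⟨hx, by rw [e1, e2, add_zero]⟩
  · rintro ⟨hx, e⟩
    have a1 := h₁.1 x hx
    have a2 := h₂.1 x hx
    exact ⟨⟨hx, by linarith⟩, hx, by linarith⟩

theorem CutsOut.neg_mem {m : Module.Dual ℤ N} {σ τ : PointedCone ℝ (ℝ ⊗[ℤ] N)}
    (h : CutsOut m σ τ) : -m ∈ dualMonoid σ := by
  intro x hx
  have : realForm (-m) + realForm m = 0 := by rw [← realForm_add, neg_add_cancel, realForm_zero]
  have e := LinearMap.congr_fun this x
  rw [LinearMap.add_apply, ((h.2 x).1 hx).2] at e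
  simp only [add_zero, LinearMap.zero_apply] at e
  exact e.ge

theorem CutsOut.exists_add_mem {m : Module.Dual ℤ N} {σ τ : PointedCone ℝ (ℝ ⊗[ℤ] N)}
    (hτ : IsRationalPolyhedral τ) (h : CutsOut m σ τ) {w : Module.Dual ℤ N}
    (hw : w ∈ dualMonoid σ) : ∃ n : ℕ, w + n • m ∈ dualMonoid τ := by
  obtain ⟨S, rfl⟩ := hτ
  refine ⟨S.sup fun s => (w s).natAbs, nonneg_of_mem_latticeHull _ fun s hs => ?_⟩
  rw [realForm_tmul]
  have h0 : 0 ≤ m s := by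
    have := h.1 _ (tmul_mem_latticeHull hs)
    rw [realForm_tmul] at this
    exact_mod_cast this
  have hsup : (w s).natAbs ≤ S.sup fun s => (w s).natAbs :=
    Finset.le_sup (f := fun s => (w s).natAbs) hs
  have : 0 ≤ w s + (S.sup fun s => (w s).natAbs : ℕ) * m s := by
    rcases h0.eq_or_lt with h1 | h1
    · rw [← h1, mul_zero, add_zero]
      have := hw _ ((h.2 _).2 ⟨tmul_mem_latticeHull hs, by rw [realForm_tmul, ← h1]; simp⟩)
      rw [realForm_tmul] at this
      exact_mod_cast this
    · have h2 : ((S.sup fun s => (w s).natAbs : ℕ) : ℤ) * 1 ≤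
          ((S.sup fun s => (w s).natAbs : ℕ) : ℤ) * m s := by gcongr; omega
      omega
  have h3 : (0 : ℝ) ≤ ((w s + (S.sup fun s => (w s).natAbs : ℕ) * m s : ℤ) : ℝ) := by
    exact_mod_cast this
  simpa using h3

end Cones

section Algebra

variable (k : Type u) [Field k] {M : Type u} [AddCommGroup M]

theorem isLocalization_away {A B : AddSubmonoid M} (h : A ≤ B) (a : A) (ha : -(a : M) ∈ B)
    (hB : ∀ b ∈ B, ∃ n : ℕ, b + n • (a : M) ∈ A) :
    letI := (AddMonoidAlgebra.mapDomainRingHom k (AddSubmonoid.inclusion h)).toAlgebra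
    IsLocalization.Away (AddMonoidAlgebra.single a (1 : k)) (AddMonoidAlgebra k B) := by
  let _ := (AddMonoidAlgebra.mapDomainRingHom k (AddSubmonoid.inclusion h)).toAlgebra
  have hmap : ∀ x : A, ∀ r : k, algebraMap (AddMonoidAlgebra k A) (AddMonoidAlgebra k B)
      (AddMonoidAlgebra.single x r) = AddMonoidAlgebra.single (AddSubmonoid.inclusion h x) r := by
    intro x r
    simp [RingHom.algebraMap_toAlgebra]
  have hpow : ∀ n : ℕ, (AddMonoidAlgebra.single a (1 : k)) ^ n =
      AddMonoidAlgebra.single (n • a) (1 : k) := by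
    intro n; simp [AddMonoidAlgebra.single_pow]
  have hunit : IsUnit (algebraMap (AddMonoidAlgebra k A) (AddMonoidAlgebra k B)
      (AddMonoidAlgebra.single a 1)) := by
    rw [hmap]
    refine IsUnit.of_mul_eq_one (AddMonoidAlgebra.single ⟨-(a : M), ha⟩ 1) ?_
    rw [AddMonoidAlgebra.single_mul_single, AddMonoidAlgebra.one_def]
    congr 1
    · ext; simp
    · simp
  have hinj : Function.Injective (algebraMap (AddMonoidAlgebra k A) (AddMonoidAlgebra k B)) :=
    AddMonoidAlgebra.mapDomain_injective (AddSubmonoid.inclusion_injective h)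
  refine (isLocalization_iff _ _).2 ⟨?_, ?_, ?_⟩
  · rintro ⟨_, n, rfl⟩
    rw [map_pow]
    exact hunit.pow n
  · intro z
    suffices H : ∃ n : ℕ, ∃ x : AddMonoidAlgebra k A,
        z * algebraMap _ _ (AddMonoidAlgebra.single a (1 : k) ^ n) = algebraMap _ _ x by
      obtain ⟨n, x, hx⟩ := H
      exact ⟨⟨x, ⟨_, n, rfl⟩⟩, hx⟩
    induction z using AddMonoidAlgebra.induction_linear with
    | zero => exact ⟨0, 0, by simp⟩
    | add f g hf hg =>
      obtain ⟨n, x, hx⟩ := hf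
      obtain ⟨n', x', hx'⟩ := hg
      refine ⟨n + n', x * AddMonoidAlgebra.single a (1 : k) ^ n' +
        x' * AddMonoidAlgebra.single a (1 : k) ^ n, ?_⟩
      rw [map_add, map_mul, map_mul, ← hx, ← hx', pow_add, map_mul]
      ring
    | single b r =>
      obtain ⟨n, hn⟩ := hB b b.2
      refine ⟨n, AddMonoidAlgebra.single ⟨_, hn⟩ r, ?_⟩
      rw [hpow, hmap, hmap, AddMonoidAlgebra.single_mul_single]
      congr 1
      simp
  · intro x y hxy
    exact ⟨1, by rw [hinj hxy]⟩

end Algebra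

/-- A fan in the lattice `N`: a finite nonempty set of strongly convex rational polyhedral cones
in `N_ℝ` that contains every face of its members and in which any two members meet in a common
face. (Nonemptiness is recorded as membership of the zero cone, which is a face of every strongly
convex cone.) -/
structure Fan (N : Type u) [AddCommGroup N] where
  cones : Set (PointedCone ℝ (ℝ ⊗[ℤ] N))
  finite : cones.Finite
  zero_mem : ⊥ ∈ cones
  rational : ∀ σ ∈ cones, IsRationalPolyhedral σ
  stronglyConvex : ∀ σ ∈ cones, ∀ x ∈ σ, -x ∈ σ → x = 0
  face_mem : ∀ σ ∈ cones, ∀ τ, IsFace τ σ → τ ∈ cones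
  inter_isFace : ∀ σ ∈ cones, ∀ τ ∈ cones, IsFace (σ ⊓ τ) σ

section Variety

variable (k : Type u) [Field k] {N : Type u} [AddCommGroup N]

/-- The torus `T_N = Spec k[M]`. -/
abbrev torus (N : Type u) [AddCommGroup N] : Scheme.{u} :=
  Spec (CommRingCat.of (AddMonoidAlgebra k (Module.Dual ℤ N)))

/-- The affine toric variety `U_σ = Spec k[σ^∨ ∩ M]`. -/
abbrev affineChart (σ : PointedCone ℝ (ℝ ⊗[ℤ] N)) : Scheme.{u} :=
  Spec (CommRingCat.of (AddMonoidAlgebra k (dualMonoid σ)))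

/-- The morphism `U_σ ⟶ U_τ` for `σ ⊆ τ`, given by the inclusion of semigroup algebras. -/
def affineChartMap {σ τ : PointedCone ℝ (ℝ ⊗[ℤ] N)} (h : σ ≤ τ) :
    affineChart k σ ⟶ affineChart k τ :=
  Spec.map (CommRingCat.ofHom
    (AddMonoidAlgebra.mapDomainRingHom k (AddSubmonoid.inclusion (dualMonoid_anti h))))

theorem CutsOut.isOpenImmersion {m : Module.Dual ℤ N} {σ τ : PointedCone ℝ (ℝ ⊗[ℤ] N)}
    (hτ : IsRationalPolyhedral τ) (h : CutsOut m σ τ) (hle : σ ≤ τ) :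
    IsOpenImmersion (affineChartMap k hle) ∧
      Set.range (affineChartMap k hle) =
        (PrimeSpectrum.basicOpen (AddMonoidAlgebra.single (⟨m, h.1⟩ : dualMonoid τ) (1 : k)) :
          Set (PrimeSpectrum (AddMonoidAlgebra k (dualMonoid τ)))) := by
  let _ := (AddMonoidAlgebra.mapDomainRingHom k
    (AddSubmonoid.inclusion (dualMonoid_anti hle))).toAlgebra
  have hloc : IsLocalization.Away (AddMonoidAlgebra.single (⟨m, h.1⟩ : dualMonoid τ) (1 : k))
      (AddMonoidAlgebra k (dualMonoid σ)) :=
    isLocalization_away k (dualMonoid_anti hle) ⟨m, h.1⟩ h.neg_mem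
      fun b hb => h.exists_add_mem hτ hb
  exact ⟨IsOpenImmersion.of_isLocalization
      (AddMonoidAlgebra.single (⟨m, h.1⟩ : dualMonoid τ) (1 : k)),
    PrimeSpectrum.localization_away_comap_range _ _⟩

variable (Δ : Fan N)

/-- The diagram of the charts `U_σ`, indexed by the cones of the fan ordered by inclusion. -/
def Fan.chartFunctor : Δ.cones ⥤ Scheme.{u} where
  obj σ := affineChart k σ.1
  map f := affineChartMap k (leOfHom f)
  map_id σ := by
    refine Eq.trans ?_ (Spec.map_id _)
    refine congrArg Spec.map (CommRingCat.hom_ext ?_)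
    exact AddMonoidAlgebra.mapDomainRingHom_id (R := k) (M := dualMonoid σ.1)
  map_comp {σ τ ρ} f g := by
    refine Eq.trans ?_ (Spec.map_comp _ _)
    refine congrArg Spec.map (CommRingCat.hom_ext ?_)
    exact (AddMonoidAlgebra.mapDomainRingHom_comp (R := k)
      (AddSubmonoid.inclusion (dualMonoid_anti (leOfHom f)))
      (AddSubmonoid.inclusion (dualMonoid_anti (leOfHom g))))

theorem Fan.isFace_of_le {σ τ : Δ.cones} (h : σ ≤ τ) : IsFace σ.1 τ.1 := by
  have := Δ.inter_isFace τ.1 τ.2 σ.1 σ.2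
  rwa [inf_eq_right.2 h] at this

theorem Fan.exists_cutsOut [Module.Finite ℤ N] {σ τ : Δ.cones} (h : σ ≤ τ) :
    ∃ m, CutsOut m σ.1 τ.1 :=
  (Δ.isFace_of_le h).exists_cutsOut (Δ.rational _ τ.2)

instance [Module.Finite ℤ N] {σ τ : Δ.cones} (f : σ ⟶ τ) :
    IsOpenImmersion ((Δ.chartFunctor k).map f) := by
  obtain ⟨m, hm⟩ := Δ.exists_cutsOut (leOfHom f)
  exact (hm.isOpenImmersion k (Δ.rational _ τ.2) (leOfHom f)).1

instance [Module.Finite ℤ N] : (Δ.chartFunctor k ⋙ Scheme.forget).IsLocallyDirected where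
  cond {σ₁ σ₂ τ} f₁ f₂ x₁ x₂ hx := by
    obtain ⟨m₁, h₁⟩ := Δ.exists_cutsOut (leOfHom f₁)
    obtain ⟨m₂, h₂⟩ := Δ.exists_cutsOut (leOfHom f₂)
    have hτ := Δ.rational _ τ.2
    let ρ : Δ.cones := ⟨σ₁.1 ⊓ σ₂.1,
      Δ.face_mem _ σ₁.2 _ (Δ.inter_isFace _ σ₁.2 _ σ₂.2)⟩
    have r₁ : ρ ≤ σ₁ := inf_le_left (a := σ₁.1)
    have r₂ : ρ ≤ σ₂ := inf_le_right (a := σ₁.1)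
    obtain ⟨o₁, e₁⟩ := h₁.isOpenImmersion k hτ (leOfHom f₁)
    obtain ⟨o₂, e₂⟩ := h₂.isOpenImmersion k hτ (leOfHom f₂)
    have h₃ : CutsOut (m₁ + m₂) ρ.1 τ.1 := h₁.inf h₂
    obtain ⟨o₃, e₃⟩ := h₃.isOpenImmersion k hτ (r₁.trans (leOfHom f₁))
    change affineChartMap k (leOfHom f₁) x₁ = affineChartMap k (leOfHom f₂) x₂ at hx
    have m1 : affineChartMap k (leOfHom f₁) x₁ ∈ Set.range (affineChartMap k (leOfHom f₁)) :=
      ⟨x₁, rfl⟩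
    have m2 : affineChartMap k (leOfHom f₁) x₁ ∈ Set.range (affineChartMap k (leOfHom f₂)) :=
      ⟨x₂, hx.symm⟩
    have m3 : affineChartMap k (leOfHom f₁) x₁ ∈
        Set.range (affineChartMap k (r₁.trans (leOfHom f₁))) := by
      rw [e₃]
      rw [e₁] at m1
      rw [e₂] at m2
      have : (AddMonoidAlgebra.single (⟨m₁ + m₂, h₃.1⟩ : dualMonoid τ.1) (1 : k)) =
          AddMonoidAlgebra.single (⟨m₁, h₁.1⟩ : dualMonoid τ.1) (1 : k) *
          AddMonoidAlgebra.single (⟨m₂, h₂.1⟩ : dualMonoid τ.1) (1 : k) := by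
        rw [AddMonoidAlgebra.single_mul_single, one_mul]
        rfl
      rw [this, PrimeSpectrum.basicOpen_mul]
      exact ⟨m1, m2⟩
    obtain ⟨z, hz⟩ := m3
    refine ⟨ρ, homOfLE r₁, homOfLE r₂, z, ?_, ?_⟩
    · apply o₁.base_open.injective
      refine Eq.trans ?_ hz
      exact congrArg (fun g => g z)
        (congrArg (fun g : affineChart k ρ.1 ⟶ affineChart k τ.1 => (g : _ → _))
          ((Δ.chartFunctor k).map_comp (homOfLE r₁) f₁).symm)
    · apply o₂.base_open.injective
      refine Eq.trans ?_ (hz.trans hx)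
      exact congrArg (fun g => g z)
        (congrArg (fun g : affineChart k ρ.1 ⟶ affineChart k τ.1 => (g : _ → _))
          ((Δ.chartFunctor k).map_comp (homOfLE r₂) f₂).symm)

variable [Module.Finite ℤ N]

/-- The toric variety `X(Δ)`: the charts `U_σ`, `σ ∈ Δ`, glued along `U_σ ∩ U_τ = U_{σ ∩ τ}`. -/
def Fan.variety : Scheme.{u} := colimit (Δ.chartFunctor k)

/-- The open immersion `U_σ ⟶ X(Δ)`. -/
def Fan.chart (σ : Δ.cones) : affineChart k σ.1 ⟶ Δ.variety k :=
  colimit.ι (Δ.chartFunctor k) σ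

/-- The structure morphism `X(Δ) ⟶ Spec k`. -/
def Fan.structureMap : Δ.variety k ⟶ Spec (CommRingCat.of k) :=
  colimit.desc (Δ.chartFunctor k)
    { pt := Spec (CommRingCat.of k)
      ι :=
        { app := fun σ => Spec.map (CommRingCat.ofHom
            (algebraMap k (AddMonoidAlgebra k (dualMonoid σ.1))))
          naturality := by
            intro σ τ f
            refine ((Spec.map_comp _ _).symm.trans ?_).trans (Category.comp_id _).symm
            congr 1
            ext x
            simp } }

/-- The embedding `T_N ⟶ X(Δ)` of the torus, through the chart of the zero cone (for which
`σ^∨ ∩ M = M`). -/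
def Fan.torusEmbedding : torus k N ⟶ Δ.variety k :=
  Spec.map (CommRingCat.ofHom (AddMonoidAlgebra.mapDomainRingHom k
    (dualMonoid (⊥ : PointedCone ℝ (ℝ ⊗[ℤ] N))).subtype)) ≫ Δ.chart k ⟨⊥, Δ.zero_mem⟩

end Variety

section Maps

variable (k : Type u) [Field k] {N N' : Type u} [AddCommGroup N] [AddCommGroup N']

/-- The homomorphism of tori `T_N ⟶ T_N'` defined by a lattice map `φ : N → N'`; on coordinate
rings it is `χ^m ↦ χ^(m ∘ φ)`. -/
def torusMap (φ : N →ₗ[ℤ] N') : torus k N ⟶ torus k N' :=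
  Spec.map (CommRingCat.ofHom (AddMonoidAlgebra.mapDomainRingHom k
    (Module.Dual.transpose (R := ℤ) φ).toAddMonoidHom))

/-- `f : X(Δ) ⟶ X(Δ')` is the toric map corresponding to the lattice map `φ`: a morphism of
`k`-schemes that restricts on the tori to the homomorphism of algebraic groups defined by `φ`.
(Since the torus is dense in `X(Δ)`, such a morphism is equivariant and determined by `φ`.) -/
structure IsToricMap [Module.Finite ℤ N] [Module.Finite ℤ N'] {Δ : Fan N} {Δ' : Fan N'}
    (φ : N →ₗ[ℤ] N') (f : Δ.variety k ⟶ Δ'.variety k) : Prop where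
  comp_structureMap : f ≫ Δ'.structureMap k = Δ.structureMap k
  torusEmbedding_comp : Δ.torusEmbedding k ≫ f = torusMap k φ ≫ Δ'.torusEmbedding k

end Maps

/-- A fibration: a proper morphism `f : X ⟶ Y` for which the canonical map `𝒪_Y ⟶ f_* 𝒪_X` is an
isomorphism of sheaves. -/
structure IsFibration {X Y : Scheme.{u}} (f : X ⟶ Y) : Prop where
  proper : IsProper f
  isIso_app : ∀ U : Y.Opens, IsIso (f.app U)

/-- `X ⟶ Z ⟶ Y` is the Stein factorization of `f`: the factorization, unique up to unique
isomorphism, into a fibration followed by a finite morphism. -/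
structure IsSteinFactorization {X Z Y : Scheme.{u}} (f : X ⟶ Y) (g : X ⟶ Z) (h : Z ⟶ Y) :
    Prop where
  fac : g ≫ h = f
  fibration : IsFibration g
  finite : IsFinite h
  unique : ∀ (Z' : Scheme.{u}) (g' : X ⟶ Z') (h' : Z' ⟶ Y), g' ≫ h' = f → IsFibration g' →
    IsFinite h' → ∃! e : Z ≅ Z', g ≫ e.hom = g' ∧ e.hom ≫ h' = h

end Toric

end

/-! Everything is tested on the tori. The ring $k[\sigma^\vee\cap M]$ is cut out of $k[M]$ by weight
inequalities, one for each lattice generator of $\sigma$. An inequality on weights says that a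
$t$-adic valuation is nonnegative, and such conditions pass to integral elements. Hence $X(\Delta)$
is its own relative normalization in its torus. This makes the torus dense, and gives the torus
embedding unique lifts against integral morphisms (`existsUnique_lift_of_isIso_fromNormalization`).

A morphism with $\mathcal O\cong f_*\mathcal O$ is likewise its own normalization. For a universally
closed quasi-separated $f$ the converse holds, because sections over the preimage of an affine open
are integral over the base. So the fibration condition becomes a statement about integral closure of
rings, and the uniqueness of the Stein factorization becomes a lifting property.

(i) A proper map is surjective once it is dominant. Dominance can be tested on the tori, where it
means that $M_Y\to M_X$ is injective, that is, that the cokernel of $f_N$ is torsion.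

(ii), "if": when $f_N$ is surjective, the valuation argument shows that $k[\tau^\vee\cap M_Y]$ is
integrally closed in all of $k[M_X]$, hence in $\Gamma(f^{-1}U_\tau,\mathcal O)\subseteq k[M_X]$.

(iii) The map $h$ is finite: by Dickson's lemma, finitely many translates of the monoid of forms
that extend to $N_Y$ cover $\sigma^\vee\cap M_Z$. The map $g$ comes from lifting the torus map
against $h$, and is a fibration by (ii), since $N_X\to N_Z$ is surjective.

(ii), "only if": a fibration is surjective, so (iii) applies. Uniqueness makes $h$ an isomorphism,
so every form on $N_Z$ extends to $N_Y$, which forces $N_Z=N_Y$. -/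

noncomputable section

set_option maxSynthPendingDepth 3

namespace AlgebraicGeometry

/-! ### Relative normalization, lifting against integral morphisms, and $\mathcal O\to f_*\mathcal
O$. -/

section Normalization

variable {X Y : Scheme.{u}}

/-- The relative normalization of `Y` in `X` is `Y` if `𝒪_Y` is integrally closed in `f_* 𝒪_X`
over an affine open cover. -/
theorem isIso_fromNormalization_of_iSup_eq_top (f : X ⟶ Y) [QuasiCompact f] [QuasiSeparated f]
    {ι : Type*} (U : ι → Y.Opens) (hU : iSup U = ⊤) (haff : ∀ i, IsAffineOpen (U i))
    (hinj : ∀ i, Function.Injective (f.app (U i)))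
    (hintegral : ∀ i s, (f.app (U i)).hom.IsIntegralElem s → s ∈ Set.range (f.app (U i))) :
    IsIso f.fromNormalization := by
  change MorphismProperty.isomorphisms Scheme.{u} f.fromNormalization
  refine (IsZariskiLocalAtTarget.iff_of_iSup_eq_top
    (P := MorphismProperty.isomorphisms Scheme.{u}) U hU).2 fun i => ?_
  have : IsAffine (U i) := haff i
  have : IsAffine (f.fromNormalization ⁻¹ᵁ U i) := (haff i).preimage f.fromNormalization
  suffices IsIso (f.fromNormalization ∣_ U i).appTop from
    (MorphismProperty.arrow_mk_iso_iff (.isomorphisms _)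
      (arrowIsoSpecΓOfIsAffine (f.fromNormalization ∣_ U i))).2
      (inferInstanceAs (IsIso (Spec.map (f.fromNormalization ∣_ U i).appTop)))
  have key : IsIso (f.fromNormalization.app (U i)) := by
    rw [f.fromNormalization_app (haff i)]
    let := (f.app (U i)).hom.toAlgebra
    have : IsIso (CommRingCat.ofHom
        (algebraMap Γ(Y, U i) (integralClosure Γ(Y, U i) Γ(X, f ⁻¹ᵁ U i)))) := by
      rw [ConcreteCategory.isIso_iff_bijective]
      constructor
      · intro a b hab
        exact hinj i (congrArg Subtype.val hab)
      · intro s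
        obtain ⟨a, ha⟩ := hintegral i s.1 s.2
        exact ⟨a, Subtype.ext ha⟩
    infer_instance
  have : IsIso (f.fromNormalization.app ((U i).ι ''ᵁ ⊤)) := by
    rwa [Scheme.Opens.ι_image_top]
  rw [morphismRestrict_appTop]
  exact IsIso.comp_isIso' this (Functor.map_isIso _ _)

/-- If `Y` is its own relative normalization in `X`, then `f : X ⟶ Y` has the unique left lifting
property against integral morphisms. -/
theorem existsUnique_lift_of_isIso_fromNormalization (f : X ⟶ Y) [QuasiCompact f]
    [QuasiSeparated f] [IsIso f.fromNormalization] {S T : Scheme.{u}} (h : T ⟶ S)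
    [IsIntegralHom h] (t : X ⟶ T) (b : Y ⟶ S) (w : t ≫ h = f ≫ b) :
    ∃! g : Y ⟶ T, f ≫ g = t ∧ g ≫ h = b := by
  have hto : f ≫ inv f.fromNormalization = f.toNormalization := by
    rw [IsIso.comp_inv_eq, f.toNormalization_fromNormalization]
  -- The base change of `h` along `b` is integral over `Y` and receives `X`. It therefore receives
  -- the normalization of `Y` in `X`, which is `Y` itself.
  have hlift : f = pullback.lift f t w.symm ≫ pullback.fst b h := (pullback.lift_fst _ _ _).symm
  refine ⟨inv f.fromNormalization ≫ f.normalizationDesc (pullback.lift f t w.symm)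
    (pullback.fst b h) hlift ≫ pullback.snd b h, ⟨?_, ?_⟩, ?_⟩
  · rw [reassoc_of% hto, f.toNormalization_normalizationDesc_assoc, pullback.lift_snd]
  · rw [Category.assoc, Category.assoc, ← pullback.condition, f.normalizationDesc_comp_assoc,
      IsIso.inv_hom_id_assoc]
  · rintro g ⟨hg₁, hg₂⟩
    rw [IsIso.eq_inv_comp]
    have := Scheme.Hom.normalization.hom_ext f
      (f.fromNormalization ≫ pullback.lift (𝟙 Y) g (by simp [hg₂]))
      (f.normalizationDesc (pullback.lift f t w.symm) (pullback.fst b h) hlift)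
      (pullback.fst b h) ?_ (by simp [pullback.lift_fst]) (by simp)
    · rw [← this]; simp [pullback.lift_snd]
    · rw [f.toNormalization_fromNormalization_assoc, f.toNormalization_normalizationDesc]
      apply pullback.hom_ext <;> simp [hg₁, pullback.lift_fst, pullback.lift_snd]

theorem isIso_fromNormalization_of_isIso_app (f : X ⟶ Y) [QuasiCompact f] [QuasiSeparated f]
    (hf : ∀ U : Y.Opens, IsIso (f.app U)) : IsIso f.fromNormalization := by
  have hb := fun U => (ConcreteCategory.isIso_iff_bijective (f.app U)).1 (hf U)
  exact isIso_fromNormalization_of_iSup_eq_top f (fun U : Y.affineOpens => U.1)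
    (iSup_affineOpens_eq_top Y) (fun U => U.2) (fun U => (hb U).1) fun U s _ => (hb U).2 s

/-- A morphism that is an isomorphism on sections over all affine opens is an isomorphism on
sections over all opens. -/
theorem isIso_app_of_isAffineOpen (f : X ⟶ Y)
    (hf : ∀ U : Y.Opens, IsAffineOpen U → IsIso (f.app U)) (U : Y.Opens) : IsIso (f.app U) := by
  let F : Y.sheaf ⟶ (TopCat.Sheaf.pushforward CommRingCat f.base).obj X.sheaf := ⟨f.c⟩
  have hF : IsIso F := TopCat.Sheaf.isIso_iff_isIso_basis (B := fun U : Y.affineOpens => U.1)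
    (by simpa using Y.isBasis_affineOpens) fun U => hf U.1 U.2
  have h2 : IsIso ((sheafToPresheaf _ _).map F) :=
    @Functor.map_isIso _ _ _ _ _ _ (sheafToPresheaf _ _) F hF
  exact (NatTrans.isIso_iff_isIso_app _).1 h2 (.op U)

theorem isIntegral_hom_of_comp_isIso {R A B : CommRingCat.{u}} (φ : R ⟶ A) (ψ : A ⟶ B) [IsIso ψ]
    (h : (φ ≫ ψ).hom.IsIntegral) : φ.hom.IsIntegral := by
  have e : φ = (φ ≫ ψ) ≫ inv ψ := by simp
  rw [e, CommRingCat.hom_comp]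
  exact h.trans _ _ (RingHom.isIntegral_of_surjective _
    ((ConcreteCategory.isIso_iff_bijective (inv ψ)).1 inferInstance).2)

/-- Over an affine `U`, universal closedness makes every section on the preimage integral over `Γ(Y,
U)`. The integral closure there is thus the whole ring of sections, and the hypothesis identifies it
with `Γ(Y, U)`. Integrality takes the place of coherence of $f_*\mathcal O$. -/
theorem isIso_app_of_isIso_fromNormalization (f : X ⟶ Y) [UniversallyClosed f]
    [QuasiSeparated f] [IsIso f.fromNormalization] (U : Y.Opens) : IsIso (f.app U) := by
  refine isIso_app_of_isAffineOpen f (fun U hU => ?_) U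
  have hintegral : (f.app U).hom.IsIntegral := by
    have : IsAffine U := hU
    have h := isIntegral_appTop_of_universallyClosed (f ∣_ U)
    rw [morphismRestrict_appTop] at h
    have h' := isIntegral_hom_of_comp_isIso (f.app (U.ι ''ᵁ ⊤))
      (X.presheaf.map (eqToHom (image_morphismRestrict_preimage f U ⊤)).op) h
    rwa [Scheme.Opens.ι_image_top] at h'
  have h1 : IsIso (f.fromNormalization.app U) := inferInstance
  rw [f.fromNormalization_app hU] at h1
  let := (f.app U).hom.toAlgebra
  have h2 : IsIso (CommRingCat.ofHom
      (algebraMap Γ(Y, U) (integralClosure Γ(Y, U) Γ(X, f ⁻¹ᵁ U)))) :=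
    IsIso.of_isIso_comp_right _ (f.normalizationObjIso hU).inv
  rw [ConcreteCategory.isIso_iff_bijective] at h2 ⊢
  constructor
  · intro a b hab
    exact h2.1 (Subtype.ext hab)
  · intro s
    obtain ⟨a, ha⟩ := h2.2 ⟨s, hintegral s⟩
    exact ⟨a, congrArg Subtype.val ha⟩

end Normalization

end AlgebraicGeometry

/-! ### Uniqueness of the Stein factorization. -/

namespace Toric

/-- A factorization into a fibration and a finite morphism is unique up to unique isomorphism. -/
theorem IsSteinFactorization.of_isFibration {X Z Y : Scheme.{u}} {f : X ⟶ Y} {g : X ⟶ Z}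
    {h : Z ⟶ Y} (fac : g ≫ h = f) (hg : IsFibration g) (hh : IsFinite h) :
    IsSteinFactorization f g h := by
  refine ⟨fac, hg, hh, fun Z' g' h' fac' hg' hh' => ?_⟩
  have := hg.proper
  have := hg'.proper
  have := isIso_fromNormalization_of_isIso_app g hg.isIso_app
  have := isIso_fromNormalization_of_isIso_app g' hg'.isIso_app
  obtain ⟨a, ⟨ha₁, ha₂⟩, ha⟩ := existsUnique_lift_of_isIso_fromNormalization g h' g' h
    (fac'.trans fac.symm)
  obtain ⟨b, ⟨hb₁, hb₂⟩, -⟩ := existsUnique_lift_of_isIso_fromNormalization g' h g h'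
    (fac.trans fac'.symm)
  have hab : a ≫ b = 𝟙 Z := (existsUnique_lift_of_isIso_fromNormalization g h g h rfl).unique
    ⟨by rw [reassoc_of% ha₁, hb₁], by rw [Category.assoc, hb₂, ha₂]⟩ ⟨by simp, by simp⟩
  have hba : b ≫ a = 𝟙 Z' := (existsUnique_lift_of_isIso_fromNormalization g' h' g' h' rfl).unique
    ⟨by rw [reassoc_of% hb₁, ha₁], by rw [Category.assoc, ha₂, hb₂]⟩ ⟨by simp, by simp⟩
  exact ⟨⟨a, b, hab, hba⟩, ⟨ha₁, ha₂⟩, fun e he => Iso.ext (ha _ he)⟩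

end Toric

namespace Toric

/-! ### Weights and integrality in semigroup algebras. -/

section SemigroupAlgebra

open AddMonoidAlgebra

variable (k : Type u) [Field k]

/-- The dual lattice embeds in a power of ℤ. The resulting unique sums make $k[M]$ a domain, so that
the order of Laurent series over $k[M]$ is a valuation. -/
instance twoUniqueSums_dual (N : Type*) [AddCommGroup N] : TwoUniqueSums (Module.Dual ℤ N) :=
  TwoUniqueSums.of_injective_addHom
    (⟨fun m n => m n, fun _ _ => rfl⟩ : Module.Dual ℤ N →ₙ+ (N → ℤ))
    DFunLike.coe_injective inferInstance

instance twoUniqueSums_addSubmonoid {M : Type*} [AddCommGroup M] [TwoUniqueSums M]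
    (S : AddSubmonoid M) : TwoUniqueSums S :=
  TwoUniqueSums.of_injective_addHom S.subtype.toAddHom Subtype.val_injective inferInstance

instance isDomain_addMonoidAlgebra {M : Type*} [AddCommMonoid M] [TwoUniqueSums M] :
    IsDomain (AddMonoidAlgebra k M) :=
  have : Nontrivial (AddMonoidAlgebra k M) := inferInstance
  NoZeroDivisors.to_isDomain _

variable {k} {M : Type*} [AddCommGroup M]

/-- The embedding of `k[M]` into Laurent series over `k[M]` that sends `χ^m` to `χ^m t^(w m)`. -/
def weightHom (w : M →+ ℤ) : AddMonoidAlgebra k M →+* HahnSeries ℤ (AddMonoidAlgebra k M) :=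
  liftNCRingHom (HahnSeries.C.comp (algebraMap k (AddMonoidAlgebra k M)))
    { toFun := fun m => HahnSeries.single (w m.toAdd) (single m.toAdd 1)
      map_one' := by simp; rfl
      map_mul' := fun a b => by
        simp [HahnSeries.single_mul_single, single_mul_single] } fun _ _ => mul_comm _ _

theorem weightHom_single (w : M →+ ℤ) (m : M) (r : k) :
    weightHom w (single m r) = HahnSeries.single (w m) (single m r) := by
  change liftNC _ _ _ = _
  rw [liftNC_single]
  simp [HahnSeries.C_apply, HahnSeries.single_mul_single, single_mul_single]

theorem coeff_coeff_weightHom [DecidableEq M] (w : M →+ ℤ) (s : AddMonoidAlgebra k M) (j : ℤ)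
    (m : M) : ((weightHom w s).coeff j).coeff m = if w m = j then s.coeff m else 0 := by
  induction s using AddMonoidAlgebra.induction_linear with
  | zero => simp
  | add f g hf hg =>
    simp only [map_add, HahnSeries.coeff_add, coeff_add, Finsupp.add_apply, hf, hg]
    split_ifs <;> simp
  | single a r =>
    rw [weightHom_single, HahnSeries.coeff_single]
    by_cases ha : a = m
    · subst ha
      by_cases hj : w a = j
      · simp [hj]
      · simp [hj, Ne.symm hj]
    · split_ifs <;> simp [ha]

/-- The $t$-order is the least weight in the support: monomials of equal weight cannot cancel,
because the coefficient still remembers $\chi^m$. -/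
theorem weightHom_orderTop_nonneg_iff (w : M →+ ℤ) (s : AddMonoidAlgebra k M) :
    0 ≤ (weightHom w s).orderTop ↔ ∀ m, s.coeff m ≠ 0 → 0 ≤ w m := by
  classical
  constructor
  · intro h m hm
    have h1 : (weightHom w s).coeff (w m) ≠ 0 := fun h0 => hm <| by
      have := coeff_coeff_weightHom w s (w m) m
      simpa [h0] using this.symm
    exact_mod_cast h.trans (HahnSeries.orderTop_le_of_coeff_ne_zero h1)
  · intro h
    by_contra hlt
    rw [not_le] at hlt
    obtain ⟨j, hj⟩ := WithTop.ne_top_iff_exists.1 hlt.ne_top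
    have hj0 : j < 0 := by rw [← hj] at hlt; exact_mod_cast hlt
    refine HahnSeries.coeff_orderTop_ne hj.symm ?_
    ext m
    rw [coeff_coeff_weightHom]
    split_ifs with hw
    · by_contra hm
      exact absurd (h m hm) (by omega)
    · rfl

/-- An element of `k[M]` that is integral over a ring of elements of nonnegative weights has
nonnegative weights. -/
theorem weight_nonneg_of_isIntegralElem [TwoUniqueSums M] (w : M →+ ℤ) {A : Type*} [CommRing A]
    (φ : A →+* AddMonoidAlgebra k M) (hφ : ∀ a m, (φ a).coeff m ≠ 0 → 0 ≤ w m)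
    {s : AddMonoidAlgebra k M} (hs : φ.IsIntegralElem s) (m : M) (hm : s.coeff m ≠ 0) :
    0 ≤ w m := by
  -- The ring of integers of a valuation contains every element integral over it. By `hφ`, the image
  -- of `A` lies in this ring.
  let v := AddValuation.toValuation (HahnSeries.addVal ℤ (AddMonoidAlgebra k M))
  have hv : ∀ x, v x ≤ 1 ↔ 0 ≤ x.orderTop := fun x => Iff.rfl
  let ψ : A →+* v.integer := ((weightHom w).comp φ).codRestrict v.integer fun a =>
    (hv _).2 ((weightHom_orderTop_nonneg_iff w _).2 (hφ a))
  have h : IsIntegral v.integer (weightHom w s) := by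
    have := hs.map (weightHom w)
    exact RingHom.IsIntegralElem.of_comp (f := ψ) this
  exact (weightHom_orderTop_nonneg_iff w s).1
    ((hv _).1 ((Valuation.integer.integers v).mem_of_integral h)) m hm

/-- The algebra of a monoid is finite over that of another one if finitely many translates of the
latter cover the former. -/
theorem finite_mapDomainRingHom {A B : Type*} [AddCommMonoid A] [AddCommMonoid B] (φ : A →+ B)
    (G : Set B) (hG : G.Finite) (h : ∀ b, ∃ g ∈ G, ∃ a, b = φ a + g) :
    (mapDomainRingHom k φ).Finite := by
  let _ := (mapDomainRingHom k φ).toAlgebra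
  refine ⟨⟨(hG.image fun g => single g (1 : k)).toFinset, ?_⟩⟩
  rw [eq_top_iff]
  rintro s -
  induction s using AddMonoidAlgebra.induction_linear with
  | zero => exact zero_mem _
  | add f g hf hg => exact add_mem (hf) (hg)
  | single b r =>
    obtain ⟨g, hg, a, rfl⟩ := h b
    have : single (φ a + g) r = (single a r : AddMonoidAlgebra k A) • single g (1 : k) := by
      rw [Algebra.smul_def, RingHom.algebraMap_toAlgebra]
      simp [single_mul_single]
    rw [this]
    exact Submodule.smul_mem _ _ (Submodule.subset_span (by simpa using ⟨g, hg, rfl⟩))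

end SemigroupAlgebra

/-! ### Sublattices of finite index and Dickson's lemma. -/

section Lattice

variable {N N' : Type*} [AddCommGroup N] [AddCommGroup N']

/-- An injective lattice map with finite cokernel is invertible up to a positive multiple. -/
theorem exists_quasiInverse (φ : N →ₗ[ℤ] N') (hφ : Function.Injective φ)
    [Finite (N' ⧸ LinearMap.range φ)] :
    ∃ (d : ℕ) (ψ : N' →ₗ[ℤ] N), 0 < d ∧ (∀ y, φ (ψ y) = d • y) ∧ ∀ x, ψ (φ x) = d • x := by
  -- The order of the cokernel annihilates it, so $d\,y$ always has a preimage under `φ`, which `ψ`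
  -- selects.
  let d := Nat.card (N' ⧸ LinearMap.range φ)
  have hmem : ∀ y : N', (d • LinearMap.id : N' →ₗ[ℤ] N') y ∈ LinearMap.range φ := by
    intro y
    rw [← Submodule.Quotient.mk_eq_zero]
    have : Submodule.Quotient.mk (p := LinearMap.range φ) (d • y) =
      d • Submodule.Quotient.mk (p := LinearMap.range φ) y := rfl
    exact this.trans (card_nsmul_eq_zero' ..)
  let ψ := (LinearEquiv.ofInjective φ hφ).symm.toLinearMap ∘ₗ
    LinearMap.codRestrict (LinearMap.range φ) _ hmem
  have h1 : ∀ y, φ (ψ y) = d • y := fun y => by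
    have := (LinearEquiv.ofInjective φ hφ).apply_symm_apply
      (LinearMap.codRestrict (LinearMap.range φ) _ hmem y)
    exact congrArg Subtype.val this
  exact ⟨d, ψ, Nat.card_pos, h1, fun x => hφ (by rw [h1, map_nsmul])⟩

/-- If no finite set worked, one could choose greedily a sequence in which no earlier term is
related to a later one. -/
theorem exists_finite_of_wellQuasiOrdered {α : Type*} {r : α → α → Prop}
    (hr : WellQuasiOrdered r) : ∃ G : Set α, G.Finite ∧ ∀ b, ∃ g ∈ G, r g b := by
  by_contra! h
  obtain ⟨f, -, hf⟩ := exists_seq_of_forall_finset_exists (fun _ => True) (fun x y => ¬ r x y)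
    fun s _ => by
      obtain ⟨b, hb⟩ := h s s.finite_toSet
      exact ⟨b, trivial, hb⟩
  obtain ⟨m, n, hmn, hrmn⟩ := hr f
  exact hf m n hmn hrmn

/-- The forms on `N` that are nonnegative on `S` are covered by finitely many translates of the
monoid of those which extend to `N'`. -/
theorem exists_finite_translates [Module.Finite ℤ N] (φ : N →ₗ[ℤ] N')
    (hφ : Function.Injective φ) [Finite (N' ⧸ LinearMap.range φ)] (S : Finset N) :
    ∃ G : Set (Module.Dual ℤ N), G.Finite ∧ (∀ g ∈ G, ∀ s ∈ S, 0 ≤ g s) ∧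
      ∀ m : Module.Dual ℤ N, (∀ s ∈ S, 0 ≤ m s) →
        ∃ g ∈ G, ∃ m' : Module.Dual ℤ N', (∀ s ∈ S, 0 ≤ m' (φ s)) ∧ m' ∘ₗ φ + g = m := by
  obtain ⟨d, ψ, hd, hψ, hψ'⟩ := exists_quasiInverse φ hφ
  obtain ⟨T, hT⟩ := Module.Finite.fg_top (R := ℤ) (M := N)
  have : NeZero d := ⟨hd.ne'⟩
  let B := {m : Module.Dual ℤ N // ∀ s ∈ S, 0 ≤ m s}
  -- Dickson's lemma handles the values on `S`, and finiteness handles the residues mod `d` on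
  -- generators of `N`. If `g` precedes `m` in both respects, then `m - g` is nonnegative on `S` and
  -- divisible by `d`.
  let Ψ : B → (S → ℕ) × (T → ZMod d) := fun m => (fun s => (m.1 s).toNat, fun t => (m.1 t : ZMod d))
  have hwqo : WellQuasiOrdered fun a b : B => (Ψ a).1 ≤ (Ψ b).1 ∧ (Ψ a).2 = (Ψ b).2 := fun f =>
    (wellQuasiOrdered_le (α := S → ℕ)).prod
      (Finite.wellQuasiOrdered (α := T → ZMod d) (· = ·)) fun n => Ψ (f n)
  obtain ⟨G, hG, hGB⟩ := exists_finite_of_wellQuasiOrdered hwqo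
  refine ⟨Subtype.val '' G, hG.image _, ?_, fun m hm => ?_⟩
  · rintro _ ⟨g, -, rfl⟩
    exact g.2
  obtain ⟨g, hg, hle, heq⟩ := hGB ⟨m, hm⟩
  have hdvd : ∀ n, (d : ℤ) ∣ (m - g.1) n := by
    intro n
    have hn : n ∈ Submodule.span ℤ (T : Set N) := hT ▸ Submodule.mem_top
    induction hn using Submodule.span_induction with
    | mem t ht =>
      have := congrFun heq ⟨t, ht⟩
      rw [LinearMap.sub_apply, ← ZMod.intCast_eq_intCast_iff_dvd_sub]
      exact this
    | zero => simp
    | add x y _ _ hx hy => rw [map_add]; exact dvd_add hx hy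
    | smul a x _ hx => rw [map_smul, smul_eq_mul]; exact hx.mul_left a
  -- The division by `d` is exact by `hdvd`, and `ψ ∘ φ = d` makes this an extension of `m - g`.
  let m' : Module.Dual ℤ N' := AddMonoidHom.toIntLinearMap
    { toFun := fun y => (m - g.1) (ψ y) / d
      map_zero' := by simp
      map_add' := fun x y => by rw [map_add, map_add, Int.add_ediv_of_dvd_left (hdvd _)] }
  have hm' : ∀ x, m' (φ x) = (m - g.1) x := fun x => by
    change (m - g.1) (ψ (φ x)) / d = _
    rw [hψ', map_nsmul, nsmul_eq_mul, Int.mul_ediv_cancel_left]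
    exact_mod_cast hd.ne'
  refine ⟨g.1, ⟨g, hg, rfl⟩, m', fun s hs => ?_, LinearMap.ext fun x => ?_⟩
  · rw [hm', LinearMap.sub_apply]
    have h1 : (g.1 s).toNat ≤ (m s).toNat := hle ⟨s, hs⟩
    have := g.2 s hs
    have := hm s hs
    omega
  · rw [LinearMap.add_apply, LinearMap.comp_apply, hm', LinearMap.sub_apply, sub_add_cancel]

end Lattice

end Toric

/-! ### Sections over an affine chart. -/

namespace AlgebraicGeometry

/-- The sections over an affine chart of a morphism from an affine scheme that factors through this
chart. -/
theorem exists_app_opensRange_eq {R S : CommRingCat.{u}} {X : Scheme.{u}} (φ : R ⟶ S)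
    (ι : Spec R ⟶ X) [IsOpenImmersion ι] (F : Spec S ⟶ X) (hF : F = Spec.map φ ≫ ι) :
    ∃ (α : R ≅ Γ(X, ι.opensRange)) (β : Γ(Spec S, F ⁻¹ᵁ ι.opensRange) ≅ S),
      α.hom ≫ F.app ι.opensRange ≫ β.hom = φ := by
  subst hF
  have h₁ : ι ⁻¹ᵁ ι.opensRange = ⊤ := by simp
  have h₂ : (Spec.map φ ≫ ι) ⁻¹ᵁ ι.opensRange = ⊤ := by simp
  have : IsIso (ι.app ι.opensRange) := ι.isIso_app _ le_rfl
  refine ⟨(asIso (ι.app ι.opensRange) ≪≫ (Spec R).presheaf.mapIso (eqToIso h₁.symm).op ≪≫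
    Scheme.ΓSpecIso R).symm, (Spec S).presheaf.mapIso (eqToIso h₂.symm).op ≪≫
    Scheme.ΓSpecIso S, ?_⟩
  rw [Iso.symm_hom, Iso.inv_comp_eq]
  simp only [Iso.trans_hom, asIso_hom, Scheme.Hom.comp_app, Category.assoc, Functor.mapIso_hom,
    Iso.op_hom, eqToIso.hom]
  rw [← Scheme.ΓSpecIso_naturality]
  exact (Category.assoc _ _ _).trans (congrArg (ι.app ι.opensRange ≫ ·)
    ((Spec.map φ).naturality_assoc (eqToHom h₁.symm).op _).symm)

theorem app_opensRange_injective {R S : CommRingCat.{u}} {X : Scheme.{u}} (φ : R ⟶ S)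
    (ι : Spec R ⟶ X) [IsOpenImmersion ι] (F : Spec S ⟶ X) (hF : F = Spec.map φ ≫ ι)
    (hφ : Function.Injective φ.hom) : Function.Injective (F.app ι.opensRange) := by
  obtain ⟨α, β, h⟩ := exists_app_opensRange_eq φ ι F hF
  have e : F.app ι.opensRange = α.inv ≫ φ ≫ β.inv := by
    rw [← h]; simp
  rw [e]
  have hα := ((ConcreteCategory.isIso_iff_bijective α.inv).1 inferInstance).1
  have hβ := ((ConcreteCategory.isIso_iff_bijective β.inv).1 inferInstance).1
  exact hβ.comp (hφ.comp hα)

theorem mem_range_app_opensRange {R S : CommRingCat.{u}} {X : Scheme.{u}} (φ : R ⟶ S)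
    (ι : Spec R ⟶ X) [IsOpenImmersion ι] (F : Spec S ⟶ X) (hF : F = Spec.map φ ≫ ι)
    (hφ : ∀ s, φ.hom.IsIntegralElem s → s ∈ Set.range φ.hom) (s)
    (hs : (F.app ι.opensRange).hom.IsIntegralElem s) : s ∈ Set.range (F.app ι.opensRange) := by
  obtain ⟨α, β, h⟩ := exists_app_opensRange_eq φ ι F hF
  have e : F.app ι.opensRange = α.inv ≫ φ ≫ β.inv := by
    rw [← h]; simp
  have h1 : φ.hom.IsIntegralElem (β.hom s) := by
    have h2 := hs.map β.hom.hom
    have h3 : β.hom.hom.comp (F.app ι.opensRange).hom = φ.hom.comp α.inv.hom := by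
      rw [← CommRingCat.hom_comp, ← CommRingCat.hom_comp, e]
      simp
    rw [h3] at h2
    exact h2.of_comp
  obtain ⟨r, hr⟩ := hφ _ h1
  refine ⟨α.hom r, ?_⟩
  have hβ := ((ConcreteCategory.isIso_iff_bijective β.hom).1 inferInstance).1
  apply hβ
  rw [← hr, ← h]
  rfl

end AlgebraicGeometry

namespace Toric

/-! ### Integral closedness of $k[\sigma^\vee\cap M']$ in $k[M]$. -/

section DualMonoid

variable (k : Type u) [Field k] {N N' : Type u} [AddCommGroup N] [AddCommGroup N']

/-- The homomorphism `σ^∨ ∩ M' → M` defined by a lattice map `φ : N → N'`. -/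
def dualMonoidHom (φ : N →ₗ[ℤ] N') (σ : PointedCone ℝ (ℝ ⊗[ℤ] N')) :
    dualMonoid σ →+ Module.Dual ℤ N :=
  (Module.Dual.transpose (R := ℤ) φ).toAddMonoidHom.comp (dualMonoid σ).subtype

theorem dualMonoidHom_apply (φ : N →ₗ[ℤ] N') (σ : PointedCone ℝ (ℝ ⊗[ℤ] N')) (m : dualMonoid σ) :
    dualMonoidHom φ σ m = m.1 ∘ₗ φ := rfl

theorem torusMap_id : torusMap k (LinearMap.id : N →ₗ[ℤ] N) = 𝟙 _ := by
  refine Eq.trans ?_ (Spec.map_id _)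
  refine congrArg Spec.map (CommRingCat.hom_ext ?_)
  exact AddMonoidAlgebra.mapDomainRingHom_id (R := k) (M := Module.Dual ℤ N)

theorem torusMap_comp {N'' : Type u} [AddCommGroup N''] (φ : N →ₗ[ℤ] N') (ψ : N' →ₗ[ℤ] N'') :
    torusMap k (ψ ∘ₗ φ) = torusMap k φ ≫ torusMap k ψ := by
  rw [torusMap, torusMap, torusMap, ← Spec.map_comp, ← CommRingCat.ofHom_comp,
    ← AddMonoidAlgebra.mapDomainRingHom_comp]
  rfl

theorem dualMonoidHom_injective (φ : N →ₗ[ℤ] N') (hφ : Function.Surjective φ)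
    (σ : PointedCone ℝ (ℝ ⊗[ℤ] N')) : Function.Injective (dualMonoidHom φ σ) := by
  refine fun a b hab => Subtype.ext (LinearMap.ext fun y => ?_)
  obtain ⟨x, rfl⟩ := hφ y
  exact LinearMap.congr_fun hab x

/-- For a surjective lattice map `N → N'` the ring `k[σ^∨ ∩ M']` is integrally closed in `k[M]`. -/
theorem mem_range_mapDomainRingHom_dualMonoidHom (φ : N →ₗ[ℤ] N') (hφ : Function.Surjective φ)
    {σ : PointedCone ℝ (ℝ ⊗[ℤ] N')} (hσ : IsRationalPolyhedral σ)
    (s : AddMonoidAlgebra k (Module.Dual ℤ N))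
    (hs : (AddMonoidAlgebra.mapDomainRingHom k (dualMonoidHom φ σ)).IsIntegralElem s) :
    s ∈ Set.range (AddMonoidAlgebra.mapDomainRingHom k (dualMonoidHom φ σ)) := by
  classical
  -- Evaluation at `n` is a weight that is nonnegative on the image of $\sigma^\vee\cap M'$, hence
  -- on every element integral over its algebra.
  have key : ∀ n, (1 : ℝ) ⊗ₜ[ℤ] φ n ∈ σ → ∀ m, s.coeff m ≠ 0 → 0 ≤ m n := by
    intro n hn m hm
    refine weight_nonneg_of_isIntegralElem (LinearMap.applyₗ n).toAddMonoidHom _ ?_ hs m hm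
    intro a m hm
    obtain ⟨a, -, rfl⟩ := Finset.mem_image.1
      (Finsupp.mapDomain_support (Finsupp.mem_support_iff.2 hm))
    have := a.2 _ hn
    rw [realForm_tmul] at this
    exact_mod_cast this
  suffices (s.coeff.support : Set _) ⊆ Set.range (dualMonoidHom φ σ) by
    exact ⟨_, AddMonoidAlgebra.mapDomain_comapDomain this
      (dualMonoidHom_injective φ hφ σ)⟩
  intro m hm
  have hm : s.coeff m ≠ 0 := by simpa using hm
  -- Both `n` and `-n` map to `0 ∈ σ`, so `m` is nonnegative on both and vanishes; thus `m` descends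
  -- to `N'`.
  have hker : LinearMap.ker φ ≤ LinearMap.ker m := by
    intro n hn
    rw [LinearMap.mem_ker] at hn ⊢
    have h1 := key n (by simp [hn]) m hm
    have h2 := key (-n) (by simp [hn]) m hm
    rw [map_neg] at h2
    omega
  obtain ⟨m', rfl⟩ : ∃ m' : Module.Dual ℤ N', m' ∘ₗ φ = m := by
    refine ⟨(LinearMap.ker φ).liftQ m hker ∘ₗ (φ.quotKerEquivOfSurjective hφ).symm.toLinearMap, ?_⟩
    ext x
    have : (φ.quotKerEquivOfSurjective hφ).symm (φ x) = Submodule.Quotient.mk x := by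
      rw [LinearEquiv.symm_apply_eq]; rfl
    simp [this]
  obtain ⟨S, rfl⟩ := hσ
  refine ⟨⟨m', nonneg_of_mem_latticeHull _ fun y hy => ?_⟩, rfl⟩
  obtain ⟨x, rfl⟩ := hφ y
  rw [realForm_tmul]
  exact_mod_cast key x (tmul_mem_latticeHull hy) _ hm

theorem dualMonoid_bot : dualMonoid (⊥ : PointedCone ℝ (ℝ ⊗[ℤ] N)) = ⊤ := by
  refine eq_top_iff.2 fun m _ x hx => ?_
  rw [(Submodule.mem_bot _).1 hx, map_zero]

end DualMonoid

/-! ### Charts of a toric variety and its torus. -/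

section Charts

variable (k : Type u) [Field k] {N : Type u} [AddCommGroup N] (Δ : Fan N)

theorem bot_le_cone (σ : Δ.cones) : (⟨⊥, Δ.zero_mem⟩ : Δ.cones) ≤ σ :=
  bot_le (a := σ.1)

variable [Module.Finite ℤ N]

instance chart_isOpenImmersion (σ : Δ.cones) : IsOpenImmersion (Δ.chart k σ) :=
  inferInstanceAs (IsOpenImmersion (colimit.ι (Δ.chartFunctor k) σ))

theorem affineChartMap_comp_chart {σ τ : Δ.cones} (h : σ ≤ τ) :
    affineChartMap k h ≫ Δ.chart k τ = Δ.chart k σ :=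
  colimit.w (Δ.chartFunctor k) (homOfLE h)

theorem exists_chart_apply_eq (x : Δ.variety k) : ∃ σ y, Δ.chart k σ y = x :=
  Scheme.IsLocallyDirected.ι_jointly_surjective (Δ.chartFunctor k) x

theorem iSup_opensRange_chart : ⨆ σ, (Δ.chart k σ).opensRange = ⊤ := by
  rw [eq_top_iff]
  rintro x -
  obtain ⟨σ, y, rfl⟩ := exists_chart_apply_eq k Δ x
  exact TopologicalSpace.Opens.mem_iSup.2 ⟨σ, y, rfl⟩

theorem isAffineOpen_opensRange_chart (σ : Δ.cones) : IsAffineOpen (Δ.chart k σ).opensRange :=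
  isAffineOpen_opensRange _

instance isReduced_variety : IsReduced (Δ.variety k) :=
  have (σ : (Scheme.IsLocallyDirected.openCover (Δ.chartFunctor k)).I₀) :
      IsReduced ((Scheme.IsLocallyDirected.openCover (Δ.chartFunctor k)).X σ) :=
    inferInstanceAs (IsReduced (affineChart k σ.1))
  .of_openCover _ (Scheme.IsLocallyDirected.openCover (Δ.chartFunctor k))

variable {N' : Type u} [AddCommGroup N']

/-- The torus lies in every chart, so a map through it can be computed in any chart `τ`, where it is
the semigroup algebra map $\chi^m\mapsto\chi^{m\circ\varphi}$. -/
theorem torusMap_comp_torusEmbedding (φ : N' →ₗ[ℤ] N) (τ : Δ.cones) :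
    torusMap k φ ≫ Δ.torusEmbedding k = Spec.map (CommRingCat.ofHom
      (AddMonoidAlgebra.mapDomainRingHom k (dualMonoidHom φ τ.1))) ≫ Δ.chart k τ := by
  rw [Fan.torusEmbedding, ← affineChartMap_comp_chart k Δ (bot_le_cone Δ τ), torusMap,
    affineChartMap, ← Spec.map_comp_assoc, ← Spec.map_comp_assoc, ← CommRingCat.ofHom_comp,
    ← CommRingCat.ofHom_comp, ← AddMonoidAlgebra.mapDomainRingHom_comp,
    ← AddMonoidAlgebra.mapDomainRingHom_comp]
  rfl

theorem app_opensRange_chart_injective (φ : N' →ₗ[ℤ] N) (hφ : Function.Surjective φ)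
    (τ : Δ.cones) : Function.Injective
      ((torusMap k φ ≫ Δ.torusEmbedding k).app (Δ.chart k τ).opensRange) :=
  app_opensRange_injective _ _ _ (torusMap_comp_torusEmbedding k Δ φ τ)
    (AddMonoidAlgebra.mapDomain_injective (dualMonoidHom_injective φ hφ τ.1))

theorem mem_range_app_opensRange_chart (φ : N' →ₗ[ℤ] N) (hφ : Function.Surjective φ)
    (τ : Δ.cones) (s)
    (hs : ((torusMap k φ ≫ Δ.torusEmbedding k).app
      (Δ.chart k τ).opensRange).hom.IsIntegralElem s) :
    s ∈ Set.range ((torusMap k φ ≫ Δ.torusEmbedding k).app (Δ.chart k τ).opensRange) :=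
  mem_range_app_opensRange _ _ _ (torusMap_comp_torusEmbedding k Δ φ τ)
    (mem_range_mapDomainRingHom_dualMonoidHom k φ hφ (Δ.rational _ τ.2)) s hs

theorem torusEmbedding_eq (σ : Δ.cones) : Δ.torusEmbedding k = Spec.map (CommRingCat.ofHom
      (AddMonoidAlgebra.mapDomainRingHom k (dualMonoidHom LinearMap.id σ.1))) ≫ Δ.chart k σ := by
  rw [← torusMap_comp_torusEmbedding, torusMap_id, Category.id_comp]

instance torusEmbedding_isOpenImmersion : IsOpenImmersion (Δ.torusEmbedding k) := by
  have : IsIso (Spec.map (CommRingCat.ofHom (AddMonoidAlgebra.mapDomainRingHom k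
      (dualMonoid (⊥ : PointedCone ℝ (ℝ ⊗[ℤ] N))).subtype))) := by
    rw [isIso_SpecMap_iff]
    refine ⟨AddMonoidAlgebra.mapDomain_injective Subtype.val_injective, fun s => ?_⟩
    refine ⟨_, AddMonoidAlgebra.mapDomain_comapDomain (fun m _ => ?_) Subtype.val_injective⟩
    exact ⟨⟨m, dualMonoid_bot (N := N) ▸ trivial⟩, rfl⟩
  delta Fan.torusEmbedding
  infer_instance

theorem preimage_opensRange_chart {T : Scheme.{u}} (F : T ⟶ torus k N) (σ : Δ.cones) :
    (F ≫ Δ.torusEmbedding k) ⁻¹ᵁ (Δ.chart k σ).opensRange = ⊤ := by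
  rw [torusEmbedding_eq k Δ σ]
  simp

/-- The preimage of each affine chart is the whole torus, so the embedding is even affine. -/
instance torusEmbedding_quasiCompact : QuasiCompact (Δ.torusEmbedding k) := by
  suffices IsAffineHom (Δ.torusEmbedding k) from inferInstance
  refine isAffineHom_of_forall_exists_isAffineOpen _ fun x => ?_
  obtain ⟨σ, y, rfl⟩ := exists_chart_apply_eq k Δ x
  refine ⟨(Δ.chart k σ).opensRange, ⟨y, rfl⟩, isAffineOpen_opensRange_chart k Δ σ, ?_⟩
  have h := preimage_opensRange_chart k Δ (𝟙 _) σ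
  rw [Category.id_comp] at h
  rw [h]
  exact isAffineOpen_top _

/-- `X(Δ)` is integrally closed in its torus. -/
instance torusEmbedding_isIso_fromNormalization :
    IsIso (Δ.torusEmbedding k).fromNormalization := by
  refine isIso_fromNormalization_of_iSup_eq_top _ _ (iSup_opensRange_chart k Δ)
    (isAffineOpen_opensRange_chart k Δ) (fun σ => ?_) fun σ => ?_
  · have := app_opensRange_chart_injective k Δ LinearMap.id Function.surjective_id σ
    rwa [torusMap_id, Category.id_comp] at this
  · have := mem_range_app_opensRange_chart k Δ LinearMap.id Function.surjective_id σ
    rwa [torusMap_id, Category.id_comp] at this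

/-- A scheme is dense in the normalization taken in it, and here that normalization is `X(Δ)`. -/
instance torusEmbedding_isDominant : IsDominant (Δ.torusEmbedding k) := by
  rw [← (Δ.torusEmbedding k).toNormalization_fromNormalization]
  infer_instance

theorem torusEmbedding_app_injective (U : (Δ.variety k).Opens) :
    Function.Injective ((Δ.torusEmbedding k).app U) :=
  have := IsSchemeTheoreticallyDominant.of_isDominant (Δ.torusEmbedding k)
  (Δ.torusEmbedding k).app_injective U

end Charts

/-! ### Surjective lattice maps give fibrations. -/

section ToricMap

variable {k : Type u} [Field k] {N N' : Type u} [AddCommGroup N] [AddCommGroup N']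
  [Module.Finite ℤ N] [Module.Finite ℤ N'] {Δ : Fan N} {Δ' : Fan N'} {φ : N →ₗ[ℤ] N'}
  {f : Δ.variety k ⟶ Δ'.variety k}

/-- A proper toric map given by a surjective lattice map is a fibration. -/
theorem IsToricMap.isFibration (hf : IsToricMap k φ f) (hproper : IsProper f)
    (hφ : Function.Surjective φ) : IsFibration f := by
  refine ⟨hproper, ?_⟩
  suffices IsIso f.fromNormalization from isIso_app_of_isIso_fromNormalization f
  -- Restriction to the torus of `X` turns `f` into a semigroup algebra map on each chart of `Y`. A
  -- section integral over the chart restricts to an element that comes from the chart, and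
  -- injectivity of restriction brings this equality back to `X`.
  have hcomp : ∀ U, ((torusMap k φ ≫ Δ'.torusEmbedding k).app U) =
      f.app U ≫ (Δ.torusEmbedding k).app (f ⁻¹ᵁ U) ≫ (torus k N).presheaf.map (eqToHom (by
        rw [← hf.torusEmbedding_comp]; rfl)).op := by
    intro U
    rw [Scheme.Hom.congr_app hf.torusEmbedding_comp.symm U]
    simp
  have hinj : ∀ U, Function.Injective ((Δ.torusEmbedding k).app (f ⁻¹ᵁ U) ≫
      (torus k N).presheaf.map (eqToHom (show (torusMap k φ ≫ Δ'.torusEmbedding k) ⁻¹ᵁ U =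
        Δ.torusEmbedding k ⁻¹ᵁ f ⁻¹ᵁ U by rw [← hf.torusEmbedding_comp]; rfl)).op) := by
    intro U
    have h := ((ConcreteCategory.isIso_iff_bijective ((torus k N).presheaf.map
      (eqToHom (show (torusMap k φ ≫ Δ'.torusEmbedding k) ⁻¹ᵁ U =
        Δ.torusEmbedding k ⁻¹ᵁ f ⁻¹ᵁ U by rw [← hf.torusEmbedding_comp]; rfl)).op)).1
        inferInstance).1
    exact h.comp (torusEmbedding_app_injective k Δ _)
  refine isIso_fromNormalization_of_iSup_eq_top _ _ (iSup_opensRange_chart k Δ')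
    (isAffineOpen_opensRange_chart k Δ') (fun τ => ?_) fun τ s hs => ?_
  · have h := app_opensRange_chart_injective k Δ' φ hφ τ
    rw [hcomp] at h
    intro a b hab
    apply h
    rw [ConcreteCategory.comp_apply, hab, ← ConcreteCategory.comp_apply]
  · have h := mem_range_app_opensRange_chart k Δ' φ hφ τ
    rw [hcomp] at h
    obtain ⟨r, hr⟩ := h _ (hs.map _)
    exact ⟨r, hinj _ hr⟩

end ToricMap

end Toric

/-! ### Checking finiteness on pullbacks to charts. -/

namespace AlgebraicGeometry

/-- A property that is local at the target can be checked on pullbacks along open immersions. -/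
theorem of_forall_exists_isPullback (P : MorphismProperty Scheme.{u}) [IsZariskiLocalAtTarget P]
    {X Y : Scheme.{u}} (f : X ⟶ Y)
    (H : ∀ y : Y, ∃ (U V : Scheme.{u}) (g : U ⟶ V) (i : U ⟶ X) (j : V ⟶ Y),
      IsOpenImmersion j ∧ IsPullback g i j f ∧ P g ∧ y ∈ Set.range j) : P f := by
  choose U V g i j hj hp hg hy using H
  refine IsZariskiLocalAtTarget.of_iSup_eq_top (fun y => (j y).opensRange) ?_ fun y => ?_
  · rw [eq_top_iff]
    rintro y -
    exact TopologicalSpace.Opens.mem_iSup.2 ⟨y, hy y⟩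
  · rw [P.arrow_mk_iso_iff (morphismRestrictOpensRange f (j y)),
      ← P.cancel_left_of_respectsIso (hp y).flip.isoPullback.hom]
    simpa using hg y

theorem isFinite_of_forall_exists_isPullback {X Y : Scheme.{u}} (f : X ⟶ Y)
    (H : ∀ y : Y, ∃ (U V : Scheme.{u}) (g : U ⟶ V) (i : U ⟶ X) (j : V ⟶ Y),
      IsOpenImmersion j ∧ IsPullback g i j f ∧ IsFinite g ∧ y ∈ Set.range j) : IsFinite f :=
  @of_forall_exists_isPullback _ (HasAffineProperty.iff.1
    ((HasAffineProperty.affineAnd_iff _ RingHom.finite_respectsIso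
    RingHom.finite_localizationPreserves.away RingHom.finite_ofLocalizationSpan).2 fun {X Y} f => by
      rw [isFinite_iff, isAffineHom_iff])).1 _ _ f H

end AlgebraicGeometry

namespace Toric

/-! ### Chart morphisms defined by lattice maps. -/

section ChartMaps

variable (k : Type u) [Field k] {N N' : Type u} [AddCommGroup N] [AddCommGroup N']
  (φ : N →ₗ[ℤ] N')

theorem realForm_comp (m : Module.Dual ℤ N') (x : ℝ ⊗[ℤ] N) :
    realForm (m ∘ₗ φ) x = realForm m (φ.baseChange ℝ x) := by
  have : realForm (m ∘ₗ φ) = realForm m ∘ₗ φ.baseChange ℝ := by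
    ext n
    simp [realForm]
  exact LinearMap.congr_fun this x

/-- The pullback `τ^∨ ∩ M' → σ^∨ ∩ M` of forms along a lattice map that sends `σ` into `τ`. -/
def dualMonoidMap {σ : PointedCone ℝ (ℝ ⊗[ℤ] N)} {τ : PointedCone ℝ (ℝ ⊗[ℤ] N')}
    (h : σ.map (φ.baseChange ℝ) ≤ τ) : dualMonoid τ →+ dualMonoid σ :=
  (dualMonoidHom φ τ).codRestrict (dualMonoid σ) fun m x hx => by
    rw [dualMonoidHom_apply, realForm_comp]
    exact m.2 _ (h ⟨x, hx, rfl⟩)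

/-- The morphism `U_σ ⟶ U_τ` defined by a lattice map that sends `σ` into `τ`. -/
def chartMap {σ : PointedCone ℝ (ℝ ⊗[ℤ] N)} {τ : PointedCone ℝ (ℝ ⊗[ℤ] N')}
    (h : σ.map (φ.baseChange ℝ) ≤ τ) : affineChart k σ ⟶ affineChart k τ :=
  Spec.map (CommRingCat.ofHom (AddMonoidAlgebra.mapDomainRingHom k (dualMonoidMap φ h)))

theorem affineChartMap_comp_chartMap {σ σ' : PointedCone ℝ (ℝ ⊗[ℤ] N)}
    {τ τ' : PointedCone ℝ (ℝ ⊗[ℤ] N')} (h : σ.map (φ.baseChange ℝ) ≤ τ)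
    (h' : σ'.map (φ.baseChange ℝ) ≤ τ') (hσ : σ ≤ σ') (hτ : τ ≤ τ') :
    affineChartMap k hσ ≫ chartMap k φ h' = chartMap k φ h ≫ affineChartMap k hτ := by
  rw [affineChartMap, affineChartMap, chartMap, chartMap, ← Spec.map_comp, ← Spec.map_comp,
    ← CommRingCat.ofHom_comp, ← CommRingCat.ofHom_comp, ← AddMonoidAlgebra.mapDomainRingHom_comp,
    ← AddMonoidAlgebra.mapDomainRingHom_comp]
  rfl

end ChartMaps

/-! ### The fan in a sublattice of finite index and its finite toric map. -/

section Comap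

variable {N N' : Type u} [AddCommGroup N] [AddCommGroup N'] (φ : N →ₗ[ℤ] N')

theorem map_latticeHull [DecidableEq N'] (S : Finset N) :
    (latticeHull S).map (φ.baseChange ℝ) = latticeHull (S.image φ) := by
  refine (Submodule.map_span ((φ.baseChange ℝ).restrictScalars _) _).trans ?_
  rw [latticeHull, Finset.coe_image, Set.image_image, Set.image_image]
  simp [PointedCone.hull]

variable {φ} in
theorem mem_map_iff (hφ : Function.Injective (φ.baseChange ℝ)) {σ : PointedCone ℝ (ℝ ⊗[ℤ] N)}
    {x : ℝ ⊗[ℤ] N} : φ.baseChange ℝ x ∈ σ.map (φ.baseChange ℝ) ↔ x ∈ σ :=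
  ⟨fun ⟨_, hy, e⟩ => hφ e ▸ hy, fun h => ⟨x, h, rfl⟩⟩

theorem baseChange_comp_eq_smul {φ : N →ₗ[ℤ] N'} {ψ : N' →ₗ[ℤ] N} {d : ℕ}
    (h : ∀ x, ψ (φ x) = d • x) (x : ℝ ⊗[ℤ] N) :
    ψ.baseChange ℝ (φ.baseChange ℝ x) = (d : ℝ) • x := by
  have : ψ.baseChange ℝ ∘ₗ φ.baseChange ℝ = (d : ℝ) • LinearMap.id := by
    ext y
    simp [h, Nat.cast_smul_eq_nsmul]
  exact LinearMap.congr_fun this x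

variable [Finite (N' ⧸ LinearMap.range φ)]

theorem baseChange_bijective (hφ : Function.Injective φ) :
    Function.Bijective (φ.baseChange ℝ) := by
  obtain ⟨d, ψ, hd, h1, h2⟩ := exists_quasiInverse φ hφ
  have hd' : (d : ℝ) ≠ 0 := by exact_mod_cast hd.ne'
  constructor
  · intro x y hxy
    have h := congrArg (ψ.baseChange ℝ) hxy
    rw [baseChange_comp_eq_smul h2, baseChange_comp_eq_smul h2] at h
    exact smul_right_injective _ hd' h
  · intro y
    refine ⟨(d : ℝ)⁻¹ • ψ.baseChange ℝ y, ?_⟩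
    rw [map_smul, baseChange_comp_eq_smul h1, inv_smul_smul₀ hd']

/-- Over ℝ the quasi-inverse `ψ` is `d` times the inverse of `φ`, and scaling by `d > 0` preserves
cones. So `ψ` carries lattice generators of the image to lattice generators of `σ`. -/
theorem IsRationalPolyhedral.of_map (hφ : Function.Injective φ) {σ : PointedCone ℝ (ℝ ⊗[ℤ] N)}
    (h : IsRationalPolyhedral (σ.map (φ.baseChange ℝ))) : IsRationalPolyhedral σ := by
  classical
  obtain ⟨S, hS⟩ := h
  obtain ⟨d, ψ, hd, h1, h2⟩ := exists_quasiInverse φ hφ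
  have hd' : (0 : ℝ) < d := by exact_mod_cast hd
  refine ⟨S.image ψ, ?_⟩
  rw [← map_latticeHull, ← hS]
  refine le_antisymm (fun x hx => ?_) ?_
  · refine ⟨_, ⟨(d : ℝ)⁻¹ • x, σ.smul_mem (inv_pos.2 hd').le hx, rfl⟩, ?_⟩
    exact (baseChange_comp_eq_smul h2 _).trans (smul_inv_smul₀ hd'.ne' x)
  · rintro _ ⟨_, ⟨x, hx, rfl⟩, rfl⟩
    have h := σ.smul_mem hd'.le hx
    exact (baseChange_comp_eq_smul h2 x).symm ▸ h

variable (hφ : Function.Injective φ)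

/-- The fan `Δ'` in `N'` regarded as a fan in a sublattice `N` of finite index. -/
def Fan.comap (Δ' : Fan N') : Fan N where
  cones := {σ | σ.map (φ.baseChange ℝ) ∈ Δ'.cones}
  finite := Δ'.finite.preimage fun σ _ τ _ h => by
    ext x
    rw [← mem_map_iff (baseChange_bijective φ hφ).1, h, mem_map_iff (baseChange_bijective φ hφ).1]
  zero_mem := by
    have : (⊥ : PointedCone ℝ (ℝ ⊗[ℤ] N)).map (φ.baseChange ℝ) = ⊥ := Submodule.map_bot _
    rw [Set.mem_ofPred_eq, this]
    exact Δ'.zero_mem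
  rational σ hσ := IsRationalPolyhedral.of_map φ hφ (Δ'.rational _ hσ)
  stronglyConvex σ hσ x hx hx' := by
    refine (baseChange_bijective φ hφ).1 ?_
    rw [map_zero]
    refine Δ'.stronglyConvex _ hσ _ ⟨x, hx, rfl⟩ ?_
    rw [← map_neg]
    exact ⟨-x, hx', rfl⟩
  face_mem σ hσ τ := by
    rintro ⟨ℓ, h0, h1⟩
    let e := LinearEquiv.ofBijective _ (baseChange_bijective φ hφ)
    have he : ∀ x, e.symm (φ.baseChange ℝ x) = x := e.symm_apply_apply
    refine Δ'.face_mem _ hσ _ ⟨ℓ ∘ₗ e.symm.toLinearMap, ?_, fun y => ?_⟩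
    · rintro _ ⟨x, hx, rfl⟩
      simpa [he] using h0 x hx
    · obtain ⟨x, rfl⟩ := (baseChange_bijective φ hφ).2 y
      rw [mem_map_iff (baseChange_bijective φ hφ).1, mem_map_iff (baseChange_bijective φ hφ).1, h1]
      simp [he]
  inter_isFace σ hσ τ hτ := by
    obtain ⟨ℓ, h0, h1⟩ := Δ'.inter_isFace _ hσ _ hτ
    refine ⟨ℓ ∘ₗ φ.baseChange ℝ, fun x hx => h0 _ ⟨x, hx, rfl⟩, fun x => ?_⟩
    have h2 := h1 (φ.baseChange ℝ x)
    rw [Submodule.mem_inf, mem_map_iff (baseChange_bijective φ hφ).1,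
      mem_map_iff (baseChange_bijective φ hφ).1] at h2
    exact h2

theorem Fan.image_map_comap_cones (Δ' : Fan N') :
    PointedCone.map (φ.baseChange ℝ) '' (Δ'.comap φ hφ).cones = Δ'.cones := by
  refine Set.image_preimage_eq_of_subset fun σ _ => ?_
  refine ⟨σ.comap (φ.baseChange ℝ), ?_⟩
  ext y
  obtain ⟨x, rfl⟩ := (baseChange_bijective φ hφ).2 y
  rw [mem_map_iff (baseChange_bijective φ hφ).1]
  rfl

variable (Δ' : Fan N')

/-- The cone of `Δ'` that is the image of a cone of `Δ'.comap`. -/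
def Fan.comapCone (σ : (Δ'.comap φ hφ).cones) : Δ'.cones := ⟨σ.1.map (φ.baseChange ℝ), σ.2⟩

theorem Fan.comapCone_mono {σ τ : (Δ'.comap φ hφ).cones} (h : σ ≤ τ) :
    Δ'.comapCone φ hφ σ ≤ Δ'.comapCone φ hφ τ :=
  Submodule.map_mono (f := (φ.baseChange ℝ).restrictScalars _) h

theorem Fan.comapCone_le_iff {σ τ : (Δ'.comap φ hφ).cones} :
    Δ'.comapCone φ hφ σ ≤ Δ'.comapCone φ hφ τ ↔ σ ≤ τ :=
  ⟨fun h x hx => (mem_map_iff (baseChange_bijective φ hφ).1).1 (h ⟨x, hx, rfl⟩),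
    Δ'.comapCone_mono φ hφ⟩

theorem Fan.comapCone_surjective : Function.Surjective (Δ'.comapCone φ hφ) := by
  intro τ
  obtain ⟨σ, hσ, h⟩ := (Δ'.image_map_comap_cones φ hφ).ge τ.2
  exact ⟨⟨σ, hσ⟩, Subtype.ext h⟩

variable (k : Type u) [Field k]

/-- The chart of the toric map `X(Δ'.comap) ⟶ X(Δ')`. -/
def Fan.comapChartMap (σ : (Δ'.comap φ hφ).cones) :
    affineChart k σ.1 ⟶ affineChart k (Δ'.comapCone φ hφ σ).1 :=
  chartMap k φ le_rfl

theorem Fan.comapChartMap_eq (σ : (Δ'.comap φ hφ).cones) :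
    Δ'.comapChartMap φ hφ k σ = Spec.map (CommRingCat.ofHom (AddMonoidAlgebra.mapDomainRingHom k
      (dualMonoidMap φ (σ := σ.1) (τ := (Δ'.comapCone φ hφ σ).1) le_rfl))) := rfl

variable [Module.Finite ℤ N] [Module.Finite ℤ N']

/-- The toric map `X(Δ'.comap) ⟶ X(Δ')`. -/
def Fan.comapMap : (Δ'.comap φ hφ).variety k ⟶ Δ'.variety k :=
  colimit.desc ((Δ'.comap φ hφ).chartFunctor k)
    { pt := Δ'.variety k
      ι :=
        { app := fun σ => Δ'.comapChartMap φ hφ k σ ≫ Δ'.chart k (Δ'.comapCone φ hφ σ)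
          naturality := fun σ τ f => by
            refine Eq.trans ?_ (Category.comp_id _).symm
            rw [← affineChartMap_comp_chart k Δ' (Δ'.comapCone_mono φ hφ (leOfHom f))]
            exact (reassoc_of% affineChartMap_comp_chartMap k φ le_rfl le_rfl (leOfHom f)
              (Δ'.comapCone_mono φ hφ (leOfHom f))) _ } }

theorem Fan.chart_comp_comapMap (σ : (Δ'.comap φ hφ).cones) :
    (Δ'.comap φ hφ).chart k σ ≫ Δ'.comapMap φ hφ k =
      Δ'.comapChartMap φ hφ k σ ≫ Δ'.chart k (Δ'.comapCone φ hφ σ) :=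
  colimit.ι_desc _ _

theorem Fan.comapMap_isToricMap : IsToricMap k φ (Δ'.comapMap φ hφ k) := by
  constructor
  · refine colimit.hom_ext fun σ => ?_
    change (Δ'.comap φ hφ).chart k σ ≫ _ ≫ _ = (Δ'.comap φ hφ).chart k σ ≫ _
    have h1 : ∀ τ, Δ'.chart k τ ≫ Δ'.structureMap k = Spec.map (CommRingCat.ofHom
        (algebraMap k (AddMonoidAlgebra k (dualMonoid τ.1)))) := fun τ => colimit.ι_desc _ _
    have h2 : (Δ'.comap φ hφ).chart k σ ≫ (Δ'.comap φ hφ).structureMap k =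
      Spec.map (CommRingCat.ofHom (algebraMap k (AddMonoidAlgebra k (dualMonoid σ.1)))) :=
        colimit.ι_desc _ _
    rw [h2, reassoc_of% Δ'.chart_comp_comapMap φ hφ k σ, h1, comapChartMap_eq,
      ← Spec.map_comp, ← CommRingCat.ofHom_comp]
    congr 2
    ext x
    simp
  · obtain ⟨σ, hσ⟩ := Δ'.comapCone_surjective φ hφ ⟨⊥, Δ'.zero_mem⟩
    rw [torusEmbedding_eq k _ σ, Category.assoc, chart_comp_comapMap,
      torusMap_comp_torusEmbedding k Δ' φ (Δ'.comapCone φ hφ σ), comapChartMap_eq,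
      ← Spec.map_comp_assoc, ← CommRingCat.ofHom_comp, ← AddMonoidAlgebra.mapDomainRingHom_comp]
    rfl

/-- A point of the chart of `ρ` that maps into the chart of the image of `σ` maps into the chart of
a common face, cut out of the image of `ρ` by some `m`. Then `m ∘ φ` cuts out the corresponding face
`κ` of `ρ`. Nonvanishing of $\chi^m$ at the image is nonvanishing of $\chi^{m\circ\varphi}$ at the
point, so the point lies in $U_\kappa\subseteq U_\sigma$. -/
theorem Fan.preimage_comapMap_opensRange (σ : (Δ'.comap φ hφ).cones) :
    Δ'.comapMap φ hφ k ⁻¹ᵁ (Δ'.chart k (Δ'.comapCone φ hφ σ)).opensRange =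
      ((Δ'.comap φ hφ).chart k σ).opensRange := by
  have happ : ∀ (ρ : (Δ'.comap φ hφ).cones) y,
      Δ'.comapMap φ hφ k ((Δ'.comap φ hφ).chart k ρ y) =
        Δ'.chart k (Δ'.comapCone φ hφ ρ) (Δ'.comapChartMap φ hφ k ρ y) := fun ρ y => by
    rw [← Scheme.Hom.comp_apply, ← Scheme.Hom.comp_apply, chart_comp_comapMap]
  refine le_antisymm ?_ ?_
  · rintro x ⟨z, hz⟩
    obtain ⟨ρ, y, rfl⟩ := exists_chart_apply_eq k _ x
    have hz' := hz.trans (happ ρ y)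
    obtain ⟨κ', f₁, f₂, w, hw₁, hw₂⟩ :=
      (Scheme.IsLocallyDirected.ι_eq_ι_iff (Δ'.chartFunctor k)).1 hz'
    obtain ⟨κ, rfl⟩ := Δ'.comapCone_surjective φ hφ κ'
    have hκσ : κ ≤ σ := (Δ'.comapCone_le_iff φ hφ).1 (leOfHom f₁)
    have hκρ : κ ≤ ρ := (Δ'.comapCone_le_iff φ hφ).1 (leOfHom f₂)
    obtain ⟨m, hm⟩ := Δ'.exists_cutsOut (leOfHom f₂)
    have hm' : CutsOut (m ∘ₗ φ) κ.1 ρ.1 := by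
      refine ⟨(dualMonoidMap φ (σ := ρ.1) le_rfl ⟨m, hm.1⟩).2, fun x => ?_⟩
      have h2 := hm.2 (φ.baseChange ℝ x)
      rw [comapCone, comapCone, mem_map_iff (baseChange_bijective φ hφ).1,
        mem_map_iff (baseChange_bijective φ hφ).1, ← realForm_comp] at h2
      exact h2
    have hy : y ∈ Set.range (affineChartMap k hκρ) := by
      rw [(hm'.isOpenImmersion k ((Δ'.comap φ hφ).rational _ ρ.2) hκρ).2]
      have hmem : Δ'.comapChartMap φ hφ k ρ y ∈ Set.range (affineChartMap k (leOfHom f₂)) :=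
        ⟨w, hw₂⟩
      rw [(hm.isOpenImmersion k (Δ'.rational _ (Δ'.comapCone φ hφ ρ).2) (leOfHom f₂)).2] at hmem
      refine fun hy => hmem ?_
      change AddMonoidAlgebra.mapDomainRingHom k
        (dualMonoidMap φ (σ := ρ.1) (τ := (Δ'.comapCone φ hφ ρ).1) le_rfl)
        (AddMonoidAlgebra.single _ 1) ∈ y.asIdeal
      rw [AddMonoidAlgebra.mapDomainRingHom_apply, AddMonoidAlgebra.mapDomain_single]
      exact hy
    obtain ⟨v, rfl⟩ := hy
    refine ⟨affineChartMap k hκσ v, ?_⟩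
    rw [← Scheme.Hom.comp_apply, ← Scheme.Hom.comp_apply, affineChartMap_comp_chart,
      affineChartMap_comp_chart]
  · rintro _ ⟨y, rfl⟩
    exact ⟨_, (happ σ y).symm⟩

theorem Fan.isPullback_comapChartMap (σ : (Δ'.comap φ hφ).cones) :
    IsPullback (Δ'.comapChartMap φ hφ k σ) ((Δ'.comap φ hφ).chart k σ)
      (Δ'.chart k (Δ'.comapCone φ hφ σ)) (Δ'.comapMap φ hφ k) :=
  IsOpenImmersion.isPullback _ _ _ _ (Δ'.chart_comp_comapMap φ hφ k σ)
    (Δ'.preimage_comapMap_opensRange φ hφ k σ)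

/-- The finitely many translates of `exists_finite_translates`, taken for generators of `σ`, give
characters that generate the upper coordinate ring as a module. -/
instance Fan.comapChartMap_isFinite (σ : (Δ'.comap φ hφ).cones) :
    IsFinite (Δ'.comapChartMap φ hφ k σ) := by
  refine (IsFinite.SpecMap_iff _).2 ?_
  obtain ⟨S, hS⟩ := (Δ'.comap φ hφ).rational _ σ.2
  obtain ⟨G, hG, hG0, hGm⟩ := exists_finite_translates φ hφ S
  have hmem : ∀ m : Module.Dual ℤ N, m ∈ dualMonoid σ.1 ↔ ∀ s ∈ S, 0 ≤ m s := by
    intro m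
    rw [hS]
    constructor
    · intro h s hs
      have := h _ (tmul_mem_latticeHull hs)
      rw [realForm_tmul] at this
      exact_mod_cast this
    · intro h
      refine nonneg_of_mem_latticeHull _ fun s hs => ?_
      rw [realForm_tmul]
      exact_mod_cast h s hs
  refine finite_mapDomainRingHom _ (Subtype.val ⁻¹' G)
    (hG.preimage Subtype.val_injective.injOn) fun b => ?_
  obtain ⟨g, hg, m', hm', e⟩ := hGm b.1 ((hmem _).1 b.2)
  refine ⟨⟨g, (hmem g).2 (hG0 g hg)⟩, hg, ⟨m', ?_⟩, Subtype.ext e.symm⟩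
  rintro _ ⟨x, hx, rfl⟩
  have := (hmem (m' ∘ₗ φ)).2 hm' x hx
  rwa [realForm_comp] at this

instance Fan.comapMap_isFinite : IsFinite (Δ'.comapMap φ hφ k) := by
  refine isFinite_of_forall_exists_isPullback _ fun y => ?_
  obtain ⟨τ, z, rfl⟩ := exists_chart_apply_eq k Δ' y
  obtain ⟨σ, rfl⟩ := Δ'.comapCone_surjective φ hφ τ
  exact ⟨_, _, _, _, _, inferInstance, Δ'.isPullback_comapChartMap φ hφ k σ, inferInstance, z, rfl⟩

/-- If the finite map `X(Δ'.comap) ⟶ X(Δ')` is an isomorphism, then all forms on `N` extend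
to `N'`. -/
theorem Fan.exists_comp_eq_of_isIso_comapMap [IsIso (Δ'.comapMap φ hφ k)]
    (m : Module.Dual ℤ N) : ∃ m' : Module.Dual ℤ N', m' ∘ₗ φ = m := by
  classical
  let σ : (Δ'.comap φ hφ).cones := ⟨⊥, (Δ'.comap φ hφ).zero_mem⟩
  have h : IsIso (Δ'.comapChartMap φ hφ k σ) :=
    (MorphismProperty.isomorphisms Scheme).of_isPullback
      (Δ'.isPullback_comapChartMap φ hφ k σ).flip ‹_›
  rw [comapChartMap_eq, isIso_SpecMap_iff] at h
  -- On the chart of the zero cone every form is allowed. Exponents in the image of `s` are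
  -- restrictions of exponents of `s`, so hitting $\chi^m$ makes `m` a restriction.
  obtain ⟨s, hs⟩ := h.2 (AddMonoidAlgebra.single ⟨m, dualMonoid_bot (N := N) ▸ trivial⟩ 1)
  have hm : (⟨m, dualMonoid_bot (N := N) ▸ trivial⟩ : dualMonoid σ.1) ∈
      (Finsupp.mapDomain (dualMonoidMap φ le_rfl) s.coeff).support := by
    have : Finsupp.mapDomain (dualMonoidMap φ le_rfl) s.coeff = Finsupp.single _ 1 :=
      congrArg AddMonoidAlgebra.coeff hs
    rw [this]
    simp
  obtain ⟨m', -, e⟩ := Finset.mem_image.1 (Finsupp.mapDomain_support hm)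
  exact ⟨m'.1, congrArg Subtype.val e⟩

end Comap

end Toric

namespace Toric

/-! ### Finite cokernel, dominance on tori, and extension of forms. -/

section Dominant

/-- A finite cokernel is annihilated by its order, so a form vanishing on the image vanishes.
Conversely, the cokernel modulo torsion is free, hence detected by its forms; these pull back to
forms on `N'` that vanish on the image, so they are zero and the cokernel is torsion. -/
theorem finite_quotient_range_iff {N N' : Type*} [AddCommGroup N] [AddCommGroup N']
    [Module.Finite ℤ N'] (φ : N →ₗ[ℤ] N') :
    Finite (N' ⧸ LinearMap.range φ) ↔ Function.Injective (Module.Dual.transpose (R := ℤ) φ) := by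
  constructor
  · intro _
    rw [injective_iff_map_eq_zero]
    intro m hm
    ext y
    have hy : Nat.card (N' ⧸ LinearMap.range φ) • y ∈ LinearMap.range φ := by
      rw [← Submodule.Quotient.mk_eq_zero]
      exact card_nsmul_eq_zero' (x := Submodule.Quotient.mk (p := LinearMap.range φ) y)
    obtain ⟨x, hx⟩ := hy
    have h : m (φ x) = 0 := LinearMap.congr_fun hm x
    rw [hx, map_nsmul, smul_eq_zero] at h
    exact h.resolve_left Nat.card_pos.ne'
  · intro h
    refine Module.finite_of_fg_torsion (N' ⧸ LinearMap.range φ) fun {x} => ?_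
    obtain ⟨y, rfl⟩ := Submodule.mkQ_surjective _ x
    rw [← Submodule.mem_torsion_iff, ← Submodule.Quotient.mk_eq_zero,
      ← Module.forall_dual_apply_eq_zero_iff ℤ]
    intro g
    have hg : g ∘ₗ Submodule.mkQ _ ∘ₗ (LinearMap.range φ).mkQ = 0 := by
      apply h
      ext n
      have : (LinearMap.range φ).mkQ (φ n) = 0 :=
        (Submodule.Quotient.mk_eq_zero _).2 (LinearMap.mem_range_self φ n)
      simp [Module.Dual.transpose_apply, this]
    exact LinearMap.congr_fun hg y

/-- An injective map of lattices of finite index along which all forms extend is bijective. -/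
theorem surjective_of_forall_exists_comp_eq {N N' : Type*} [AddCommGroup N] [AddCommGroup N']
    [Module.Free ℤ N] [Module.Finite ℤ N] [Module.Free ℤ N'] (φ : N →ₗ[ℤ] N')
    (hφ : Function.Injective φ) [Finite (N' ⧸ LinearMap.range φ)]
    (h : ∀ m : Module.Dual ℤ N, ∃ m' : Module.Dual ℤ N', m' ∘ₗ φ = m) :
    Function.Surjective φ := by
  obtain ⟨d, ψ, hd, h1, -⟩ := exists_quasiInverse φ hφ
  let b := Module.Free.chooseBasis ℤ N
  choose c hc using fun i => h (b.coord i)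
  -- Extending the coordinate forms gives a retraction `r` of `φ`. It is also a right inverse:
  -- $d\,y$ lies in the image of `φ`, where `φ ∘ r` is the identity, and `N'` is torsion-free.
  let r : N' →ₗ[ℤ] N := ∑ i, (c i).smulRight (b i)
  have hr : ∀ x, r (φ x) = x := fun x => by
    have : ∀ i, c i (φ x) = b.repr x i := fun i => LinearMap.congr_fun (hc i) x
    simp [r, LinearMap.sum_apply, this, b.sum_repr]
  intro y
  refine ⟨r y, ?_⟩
  have h2 : d • φ (r y) = d • y := by
    rw [← map_nsmul, ← map_nsmul, ← h1, hr]
  have hd' : (d : ℤ) ≠ 0 := by exact_mod_cast hd.ne'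
  exact smul_right_injective N' hd' (by simpa using h2)

variable (k : Type u) [Field k] {N N' : Type u} [AddCommGroup N] [AddCommGroup N']

/-- Density means that the kernel on coordinate rings is nilpotent, hence zero since the ring is
reduced; injectivity can then be read off on monomials. -/
theorem isDominant_torusMap_iff (φ : N →ₗ[ℤ] N') :
    IsDominant (torusMap k φ) ↔ Function.Injective (Module.Dual.transpose (R := ℤ) φ) := by
  have h : IsDominant (torusMap k φ) ↔ Function.Injective (AddMonoidAlgebra.mapDomainRingHom k
      (Module.Dual.transpose (R := ℤ) φ).toAddMonoidHom) := by
    rw [isDominant_iff, RingHom.injective_iff_ker_eq_bot, eq_bot_iff,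
      ← Ideal.zero_eq_bot,
      ← nilradical_eq_zero (AddMonoidAlgebra k (Module.Dual ℤ N'))]
    exact PrimeSpectrum.denseRange_comap_iff_ker_le_nilRadical _
  rw [h]
  refine ⟨fun h a b hab => ?_, fun h => AddMonoidAlgebra.mapDomain_injective h⟩
  have : AddMonoidAlgebra.single a (1 : k) = AddMonoidAlgebra.single b 1 := by
    apply h
    simp [hab]
  exact AddMonoidAlgebra.single_left_injective one_ne_zero this

end Dominant

/-! ### Surjectivity and the Stein factorization of a proper toric map. -/

section ToricMap

variable {k : Type u} [Field k] {N N' : Type u} [AddCommGroup N] [AddCommGroup N']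
  [Module.Finite ℤ N] [Module.Finite ℤ N'] {Δ : Fan N} {Δ' : Fan N'} {φ : N →ₗ[ℤ] N'}
  {f : Δ.variety k ⟶ Δ'.variety k}

/-- The image of `f` is closed, so surjective means dominant, and dominance passes to and from the
dense open tori. -/
theorem IsToricMap.surjective_iff (hf : IsToricMap k φ f) [IsProper f] :
    Surjective f ↔ Finite (N' ⧸ LinearMap.range φ) := by
  rw [finite_quotient_range_iff, ← isDominant_torusMap_iff k]
  constructor
  · intro _
    have : IsDominant (torusMap k φ ≫ Δ'.torusEmbedding k) := by
      rw [← hf.torusEmbedding_comp]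
      infer_instance
    exact .of_comp_of_isOpenImmersion _ (Δ'.torusEmbedding k)
  · intro _
    have : IsDominant (Δ.torusEmbedding k ≫ f) := by
      rw [hf.torusEmbedding_comp]
      infer_instance
    have : IsDominant f := .of_comp (Δ.torusEmbedding k) f
    infer_instance

/-- The target is its own normalization in the source, so `f` is dominant; it is also closed. -/
theorem IsFibration.surjective {X Y : Scheme.{u}} {f : X ⟶ Y} (hf : IsFibration f) :
    Surjective f := by
  have := hf.proper
  have := isIso_fromNormalization_of_isIso_app f hf.isIso_app
  have : IsDominant (f.toNormalization ≫ f.fromNormalization) := inferInstance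
  rw [f.toNormalization_fromNormalization] at this
  infer_instance

/-- A toric map lifts through the toric map defined by a sublattice of finite index that contains
the image of its lattice map. -/
theorem IsToricMap.exists_lift {L : Type u} [AddCommGroup L] [Module.Finite ℤ L]
    (ι : L →ₗ[ℤ] N') (hι : Function.Injective ι) [Finite (N' ⧸ LinearMap.range ι)]
    (ψ : N →ₗ[ℤ] L) (hf : IsToricMap k (ι ∘ₗ ψ) f) :
    ∃ g : Δ.variety k ⟶ (Δ'.comap ι hι).variety k,
      IsToricMap k ψ g ∧ g ≫ Δ'.comapMap ι hι k = f := by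
  have hh := Δ'.comapMap_isToricMap ι hι k
  -- The torus of `X` already maps to the intermediate variety. This extends over `X` because `X` is
  -- integrally closed in its torus and the map below is finite.
  obtain ⟨g, ⟨hg₁, hg₂⟩, -⟩ := existsUnique_lift_of_isIso_fromNormalization (Δ.torusEmbedding k)
    (Δ'.comapMap ι hι k) (torusMap k ψ ≫ (Δ'.comap ι hι).torusEmbedding k) f (by
      rw [hf.torusEmbedding_comp, torusMap_comp, Category.assoc, Category.assoc,
        hh.torusEmbedding_comp])
  refine ⟨g, ⟨?_, hg₁⟩, hg₂⟩
  rw [← hh.comp_structureMap, reassoc_of% hg₂, hf.comp_structureMap]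

/-- The lift `g` inherits properness from `f`, the second factor being separated, and its lattice
map is onto the image of `φ`, so it is a fibration. -/
theorem IsToricMap.exists_steinFactorization (hf : IsToricMap k φ f) [IsProper f]
    [Finite (N' ⧸ LinearMap.range (LinearMap.range φ).subtype)] :
    ∃ g : Δ.variety k ⟶ (Δ'.comap _ (LinearMap.range φ).injective_subtype).variety k,
      IsToricMap k φ.rangeRestrict g ∧ IsSteinFactorization f g
        (Δ'.comapMap _ (LinearMap.range φ).injective_subtype k) := by
  obtain ⟨g, hg, hgf⟩ := IsToricMap.exists_lift (Δ' := Δ') (LinearMap.range φ).subtype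
    (LinearMap.range φ).injective_subtype φ.rangeRestrict
    (by rwa [LinearMap.subtype_comp_codRestrict])
  have hproper : IsProper (g ≫ Δ'.comapMap _ (LinearMap.range φ).injective_subtype k) := by
    rwa [hgf]
  exact ⟨g, hg, .of_isFibration hgf
    (hg.isFibration (.of_comp g (Δ'.comapMap _ _ k)) φ.surjective_rangeRestrict) inferInstance⟩

end ToricMap

end Toric

end

/-! ### The three statements. -/

theorem mainTheorem10 {k : Type u} [Field k] [IsAlgClosed k]
    {NX NY : Type u} [AddCommGroup NX] [Module.Free ℤ NX] [Module.Finite ℤ NX]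
    [AddCommGroup NY] [Module.Free ℤ NY] [Module.Finite ℤ NY]
    (ΔX : Toric.Fan NX) (ΔY : Toric.Fan NY) (fN : NX →ₗ[ℤ] NY)
    (f : ΔX.variety k ⟶ ΔY.variety k) (hf : Toric.IsToricMap k fN f)
    (hproper : AlgebraicGeometry.IsProper f) :
    (AlgebraicGeometry.Surjective f ↔ Finite (NY ⧸ LinearMap.range fN)) ∧
    (Toric.IsFibration f ↔ Function.Surjective fN) ∧
    (AlgebraicGeometry.Surjective f →
      ∃ ΔZ : Toric.Fan (LinearMap.range fN),
        PointedCone.map ((LinearMap.range fN).subtype.baseChange ℝ) '' ΔZ.cones = ΔY.cones ∧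
        ∃ (g : ΔX.variety k ⟶ ΔZ.variety k) (h : ΔZ.variety k ⟶ ΔY.variety k),
          Toric.IsToricMap k fN.rangeRestrict g ∧
          Toric.IsToricMap k (LinearMap.range fN).subtype h ∧
          Toric.IsSteinFactorization f g h) := by
  have hfin : AlgebraicGeometry.Surjective f →
      Finite (NY ⧸ LinearMap.range (LinearMap.range fN).subtype) := fun h => by
    rw [Submodule.range_subtype]
    exact hf.surjective_iff.1 h
  refine ⟨hf.surjective_iff, ⟨fun hfib => ?_, hf.isFibration hproper⟩, fun hsurj => ?_⟩
  · have := hfin hfib.surjective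
    obtain ⟨g, -, hst⟩ := hf.exists_steinFactorization
    -- If `f` is a fibration, `f = f ≫ 𝟙` is another Stein factorization; comparison with it
    -- identifies the finite factor with an isomorphism.
    obtain ⟨e, ⟨-, he⟩, -⟩ := hst.unique _ f (𝟙 _) (Category.comp_id f) hfib inferInstance
    rw [Category.comp_id] at he
    have hiso : IsIso (ΔY.comapMap _ (LinearMap.range fN).injective_subtype k) :=
      he ▸ inferInstance
    have hs := Toric.surjective_of_forall_exists_comp_eq (LinearMap.range fN).subtype
      (LinearMap.range fN).injective_subtype (ΔY.exists_comp_eq_of_isIso_comapMap _ _ k)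
    intro y
    obtain ⟨⟨_, x, rfl⟩, rfl⟩ := hs y
    exact ⟨x, rfl⟩
  · have := hfin hsurj
    obtain ⟨g, hg, hst⟩ := hf.exists_steinFactorization
    exact ⟨_, ΔY.image_map_comap_cones _ _, g, _, hg, ΔY.comapMap_isToricMap _ _ k, hst⟩
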